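/- For every $n$ consider the functional regression model $$y_i=\beta_0+\sum_{m=1}^{M}\int_{\mathcal T_m}x_{im}(t)\beta_m(t)\,dt+\varepsilon_i,\qquad i=1,\dots,n,$$ where $\mathcal T_m\subset\mathbb R$ is compact, $\phi_{m1},\dots,\phi_{mp_m}$ ($p_m\ge1$) are B-splines, $x_{im}=\sum_{j}\omega_{imj}\phi_{mj}$ are fixed (non-random) functional predictors, $\beta_m=\sum_j b_{mj}\phi_{mj}$, and $\varepsilon_1,\dots,\varepsilon_n$ are i.i.d. $N(0,\sigma^2)$ with a constant $\sigma^2>0$. The number $M$ of predictors, the $p_m$ and all the other data and parameters except $\sigma^2$ may depend on $n$. Put $k=1+\sum_{m=1}^M p_m$ and let $\mathbf Z$ be the $n\times k$ design matrix with rows $(1,\mathbf W_{i1}^T J_1,\dots,\mathbf W_{iM}^TJ_M)$, where $\mathbf W_{im}=(\omega_{imj})_j$ and $J_m=\int_{\mathcal T_m}\phi_m\phi_m^T$, $\phi_m=(\phi_{m1},\dots,\phi_{mp_m})^T$. Let $I_0=\{m:\mathbf b_m\ne0\}$, with $\mathbf b_m=(b_{mj})_j$, and $M_0=|I_0|$.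 For $r=1,\dots,M$ let $RSS$ and $RSS_0^r$ be the residual sums of squares of the least squares fits of $(y_1,\dots,y_n)$ by all the columns of $\mathbf Z$, and by the columns that do not belong to predictor $r$. Put $T_L^r=(RSS_0^r-RSS)/(RSS/n)$ and $\pi_r=1-\Psi_{p_r}(T_L^r)$, where $\Psi_{p}$ is the distribution function of the $\chi^2_{p}$ distribution. For a level $q=q_n$, let $\hat I$ be one of the following two sets: * (Benjamini–Yekutieli) the set of indices of the $s$ smallest p-values $\pi_{(1)}\le\dots\le\pi_{(s)}$, where $s=\max\{j:\pi_{(j)}\le \frac jM\, q/\sum_{l=1}^M l^{-1}\}$, and $\hat I=\emptyset$ if there is no such $j$; * (Bonferroni) $\hat I=\{m:\pi_m\le q/M\}$. Assume that for all large $n$ the matrix $\mathbf Z$ has linearly independent columns, $M_0\ge1$, condition (C1) $k\le\sqrt n/\log n$ holds, and $q\ge M\big(\sum_{l=1}^M l^{-1}\big)/(M_0n)$; that $q\to0$ and $Mq/\log M\to0$ as $n\to\infty$ (the latter being a condition on those $n$ with $M\ge2$ only); and that the significant predictors are asymptotically distinguishable: there is a constant $c>0$ such that, for all large $n$ and all $r\in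 I_0$, $$\frac1n\sum_{i=1}^n\Big(a_0+\sum_{m=1}^M\int_{\mathcal T_m}x_{im}(t)\alpha_m(t)\,dt\Big)^2\ \ge\ c$$ for every $a_0\in\mathbb R$ and all $\alpha_m\in\operatorname{span}(\phi_{m1},\dots,\phi_{mp_m})$ with $\alpha_r=\beta_r$. Then $\lim_{n\to\infty}P(\hat I=I_0)=1$, for the Benjamini–Yekutieli selection and for the Bonferroni selection. -/

import Mathlib

open MeasureTheory ProbabilityTheory Filter Topology

noncomputable section

namespace FunReg

/-- The `j`-th B-spline of degree `d` for the knot sequence `τ` (Cox-de Boor recursion, with the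
usual convention that a quotient with denominator `0` is `0`, which is Lean's division). -/
def bspline (τ : ℕ → ℝ) : ℕ → ℕ → ℝ → ℝ
  | 0, j, t => if τ j ≤ t ∧ t < τ (j + 1) then 1 else 0
  | d + 1, j, t =>
      (t - τ j) / (τ (j + d + 1) - τ j) * bspline τ d j t
        + (τ (j + d + 2) - t) / (τ (j + d + 2) - τ (j + 1)) * bspline τ d (j + 1) t

/-- The non-random data of a functional regression model with `n` observations: number `M` of
functional predictors, number `p m` of basis functions, compact domain `T m`, B-spline degree
`deg m` and knots `knots m` (only the first `p m + deg m + 1` of them matter) of the `m`-th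
predictor, basis coefficients `W i m` of the `m`-th functional predictor of observation `i`,
and the true parameters: the intercept `β₀` and the basis coefficients `b m` of the `m`-th
functional coefficient. -/
structure Model (n : ℕ) where
  M : ℕ
  p : Fin M → ℕ
  p_pos : ∀ m, 0 < p m
  T : Fin M → Set ℝ
  T_compact : ∀ m, IsCompact (T m)
  deg : Fin M → ℕ
  knots : Fin M → ℕ → ℝ
  knots_mono : ∀ m, Monotone (knots m)
  W : Fin n → (m : Fin M) → Fin (p m) → ℝ
  β₀ : ℝ
  b : (m : Fin M) → Fin (p m) → ℝ

namespace Model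

variable {n : ℕ} (D : Model n)

/-- The basis functions `φ_{m j}`. -/
def φ (m : Fin D.M) (j : Fin (D.p m)) : ℝ → ℝ := bspline (D.knots m) (D.deg m) j

/-- The functional predictors `x_{i m}(t) = ∑ j, ω_{i m j} φ_{m j}(t)`. -/
def x (i : Fin n) (m : Fin D.M) (t : ℝ) : ℝ := ∑ j, D.W i m j * D.φ m j t

/-- The functional coefficient `∑ j, a_{m j} φ_{m j}(t)` with basis coefficients `a`. -/
def coeffFun (a : (m : Fin D.M) → Fin (D.p m) → ℝ) (m : Fin D.M) (t : ℝ) : ℝ :=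
  ∑ j, a m j * D.φ m j t

/-- The regression function `a₀ + ∑ m, ∫_{T m} x_{i m}(t) α_m(t) dt` at observation `i`, for the
intercept `a₀` and the functional coefficients `α_m = ∑ j, a_{m j} φ_{m j}`. -/
def regression (a₀ : ℝ) (a : (m : Fin D.M) → Fin (D.p m) → ℝ) (i : Fin n) : ℝ :=
  a₀ + ∑ m, ∫ t in D.T m, D.x i m t * D.coeffFun a m t

/-- The responses `y_i`, for the realization `e` of the noise. -/
def response (e : Fin n → ℝ) : EuclideanSpace ℝ (Fin n) :=
  WithLp.toLp 2 fun i => D.regression D.β₀ D.b i + e i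

/-- The set `I₀` of significant predictors. -/
def active : Finset (Fin D.M) := {m | D.b m ≠ 0}

/-- Index type of the parameters: the intercept, and the pairs `(m, j)`. -/
abbrev Param : Type := Unit ⊕ (Σ m : Fin D.M, Fin (D.p m))

/-- The number of parameters `k = 1 + ∑ m, p m`. -/
def k : ℕ := 1 + ∑ m, D.p m

/-- The cross product matrices `J_{φ_m} = ∫_{T m} φ_m(t) φ_m(t)ᵀ dt`. -/
def J (m : Fin D.M) : Matrix (Fin (D.p m)) (Fin (D.p m)) ℝ :=
  fun l j => ∫ t in D.T m, D.φ m l t * D.φ m j t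

/-- The design matrix `Z`, with rows `(1, W_{i 1}ᵀ J_{φ_1}, …, W_{i M}ᵀ J_{φ_M})`. -/
def Z : Matrix (Fin n) D.Param ℝ :=
  fun i c => match c with
    | Sum.inl _ => 1
    | Sum.inr ⟨m, j⟩ => Matrix.vecMul (D.W i m) (D.J m) j

/-- The column of `Z` with index `c`. -/
def column (c : D.Param) : EuclideanSpace ℝ (Fin n) := WithLp.toLp 2 fun i => D.Z i c

/-- The space `Ω` generated by all the columns of the design matrix. -/
def fullSpace : Submodule ℝ (EuclideanSpace ℝ (Fin n)) :=
  Submodule.span ℝ (Set.range D.column)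

/-- The space `ζ` generated under `H₀ʳ : b_r = 0`, by the columns of the design matrix that do
not belong to the `r`-th predictor. -/
def nullSpace (r : Fin D.M) : Submodule ℝ (EuclideanSpace ℝ (Fin n)) :=
  Submodule.span ℝ (D.column '' {c | ∀ j : Fin (D.p r), c ≠ Sum.inr ⟨r, j⟩})

end Model

/-- The residual sum of squares of the least squares fit of `y` in the space `S`, that is
`‖y - P y‖²` with `P` the orthogonal projection onto `S`. -/
def rss {n : ℕ} (S : Submodule ℝ (EuclideanSpace ℝ (Fin n))) (y : EuclideanSpace ℝ (Fin n)) : ℝ :=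
  ‖y - S.starProjection y‖ ^ 2

/-- The (central) chi-square distribution with `p` degrees of freedom: the law of the sum of the
squares of `p` independent standard normal variables. -/
def chiSq (p : ℕ) : Measure ℝ :=
  (Measure.pi fun _ : Fin p => gaussianReal 0 1).map fun g => ∑ i, g i ^ 2

namespace Model

variable {n : ℕ} (D : Model n)

/-- The likelihood ratio statistic `T_Lʳ = (RSS₀ʳ - RSS) / σ̃²` with `σ̃² = RSS / n`. -/
def lrStat (r : Fin D.M) (y : EuclideanSpace ℝ (Fin n)) : ℝ :=
  (rss (D.nullSpace r) y - rss D.fullSpace y) / (rss D.fullSpace y / n)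

/-- The p-value `π_r = 1 - Ψ(T_Lʳ)`, with `Ψ` the distribution function of `χ²_{p_r}`. -/
def pValue (y : EuclideanSpace ℝ (Fin n)) (r : Fin D.M) : ℝ :=
  1 - cdf (chiSq (D.p r)) (D.lrStat r y)

end Model

/-- The Bonferroni selection `{m | π_m ≤ q / M}`. -/
def bonferroni {M : ℕ} (π : Fin M → ℝ) (q : ℝ) : Finset (Fin M) :=
  {m | π m ≤ q / M}

/-- The ordered values `π_(1) ≤ … ≤ π_(M)`; the position `j : Fin M` stands for `j + 1`. -/
def ordered {M : ℕ} (π : Fin M → ℝ) (j : Fin M) : ℝ := π (Tuple.sort π j)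

/-- The number of rejections of the Benjamini-Yekutieli step-up procedure at level `q`:
`max {j | π_(j) ≤ (j / M) q / ∑_{l=1}^M l⁻¹}`, and `0` if there is no such `j`. -/
def byCount {M : ℕ} (π : Fin M → ℝ) (q : ℝ) : ℕ :=
  (Finset.univ.filter fun j : Fin M =>
    ordered π j ≤ ((j : ℝ) + 1) / M * (q / ∑ l ∈ Finset.Icc 1 M, (l : ℝ)⁻¹)).sup
      fun j => (j : ℕ) + 1

/-- The Benjamini-Yekutieli selection: the indices of the first `byCount π q` ordered values. -/
def benjaminiYekutieli {M : ℕ} (π : Fin M → ℝ) (q : ℝ) : Finset (Fin M) :=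
  (Finset.univ.filter fun j : Fin M => (j : ℕ) < byCount π q).image (Tuple.sort π)

end FunReg

end

namespace FunReg

open scoped ENNReal

/-! It suffices to find a threshold that separates the p-values with probability tending to 1:
active ones below `n⁻²`, inactive ones above `t`. For such p-values both selections return the
active set by a deterministic argument. All randomness enters through squared norms of projected
noise, which are `σ²` times chi-square variables. Tail bounds show that typically `RSS / n` is at
most `4σ²` and `σ² ≤ (1 + 4v) RSS / n`, with `v = log n / √n`. For an active predictor the design
condition makes the statistic of order `n`, so its p-value is exponentially small. For an inactive
predictor the statistic is at most `(1 + 4v)` times a `χ²_p` variable. The law of this inflated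
variable has density at most `exp(O(v X))` relative to `χ²_p` on `[0, X]`. With `X` of order `p +
log n`, (C1) bounds `v X`, and the mass beyond `X` is at most `1/n`. Hence the p-value is at most
`t` with probability at most `e⁴⁰ t + 1/n` (`measure_pValue_le_le`), and no independence of
numerator and denominator is needed. A union bound leaves `e⁴⁰ · #inactive · t + 1/√n` plus the
probability of atypical noise (`measure_not_separated_le`). The upper conditions on `q` make this
vanish; the lower one keeps the rejection thresholds above `n⁻²`. -/

/-! ### Densities of product measures and of scaled Gaussians -/

lemma lintegral_pi_prod {n : ℕ} (ν : Measure ℝ) [SigmaFinite ν] (f : Fin n → ℝ → ℝ≥0∞)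
    (hf : ∀ i, Measurable (f i)) :
    ∫⁻ x, ∏ i, f i (x i) ∂(Measure.pi fun _ : Fin n => ν) = ∏ i, ∫⁻ x, f i x ∂ν := by
  induction n with
  | zero => simp
  | succ n ih =>
    have h := (measurePreserving_piFinSuccAbove (fun _ : Fin (n + 1) => ν) 0).symm
    rw [← h.lintegral_comp_emb (MeasurableEquiv.measurableEmbedding _)]
    simp_rw [MeasurableEquiv.piFinSuccAbove_symm_apply, Fin.insertNthEquiv,
      Fin.prod_univ_succ, Equiv.coe_fn_mk, Fin.insertNth_zero, Fin.cons_zero, Fin.cons_succ]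
    rw [← ih (fun i => f i.succ) fun i => hf i.succ]
    exact lintegral_prod_mul (hf 0).aemeasurable
      (Finset.measurable_prod _ fun (i : Fin n) _ => (hf (Fin.succ i)).comp (measurable_pi_apply i)).aemeasurable

lemma pi_withDensity {n : ℕ} (ν : Measure ℝ) [IsProbabilityMeasure ν] (f : ℝ → ℝ≥0∞)
    (hf : Measurable f) [IsProbabilityMeasure (ν.withDensity f)] :
    Measure.pi (fun _ : Fin n => ν.withDensity f)
      = (Measure.pi fun _ : Fin n => ν).withDensity fun x => ∏ i, f (x i) := by
  refine Measure.pi_eq fun s hs => ?_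
  rw [withDensity_apply _ (MeasurableSet.univ_pi hs), ← lintegral_indicator (MeasurableSet.univ_pi hs)]
  simp_rw [withDensity_apply _ (hs _), ← lintegral_indicator (hs _)]
  rw [← lintegral_pi_prod ν _ fun i => hf.indicator (hs i)]
  congr 1 with x
  by_cases hx : x ∈ Set.univ.pi s
  · rw [Set.indicator_of_mem hx]
    exact Finset.prod_congr rfl fun i _ => (Set.indicator_of_mem (hx i trivial) _).symm
  · rw [Set.indicator_of_notMem hx]
    simp only [Set.mem_pi, Set.mem_univ, true_implies, not_forall] at hx
    obtain ⟨i, hi⟩ := hx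
    exact (Finset.prod_eq_zero (Finset.mem_univ i) (Set.indicator_of_notMem hi _)).symm

/-- The density of a scaled standard normal variable with respect to the standard normal law. -/
noncomputable def gaussianScaleDensity (c x : ℝ) : ℝ := c⁻¹ * Real.exp ((1 - (c ^ 2)⁻¹) / 2 * x ^ 2)

lemma measurable_gaussianScaleDensity (c : ℝ) : Measurable (gaussianScaleDensity c) := by
  unfold gaussianScaleDensity; fun_prop

lemma gaussianReal_map_mul_eq_withDensity {c : ℝ} (hc : 0 < c) :
    (gaussianReal 0 1).map (c * ·)
      = (gaussianReal 0 1).withDensity fun x => ENNReal.ofReal (gaussianScaleDensity c x) := by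
  have hv : NNReal.mk (c ^ 2) (sq_nonneg c) * 1 ≠ 0 := by
    rw [mul_one]; intro h
    have := congrArg NNReal.toReal h
    simp at this; exact hc.ne' this
  rw [gaussianReal_map_const_mul, mul_zero, gaussianReal_of_var_ne_zero _ hv,
    gaussianReal_of_var_ne_zero _ one_ne_zero,
    ← withDensity_mul _ (measurable_gaussianPDF _ _)
      (measurable_gaussianScaleDensity c).ennreal_ofReal]
  congr 1 with x
  rw [Pi.mul_apply, gaussianPDF, gaussianPDF, ← ENNReal.ofReal_mul (gaussianPDFReal_nonneg _ _ _)]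
  congr 1
  simp only [gaussianPDFReal, gaussianScaleDensity, mul_one, sub_zero, NNReal.coe_mk, NNReal.coe_one]
  rw [Real.sqrt_mul (by positivity), Real.sqrt_sq hc.le, mul_inv]
  rw [show ∀ a b u v : ℝ, a * u * (b * v) = a * b * (u * v) by intros; ring, ← Real.exp_add]
  congr 2
  field_simp
  ring

/-! ### Chi-square laws: tails and stability under scaling -/

lemma measurable_sum_sq (p : ℕ) : Measurable fun g : Fin p → ℝ => ∑ i, g i ^ 2 := by fun_prop

instance (p : ℕ) : IsProbabilityMeasure (chiSq p) :=
  Measure.isProbabilityMeasure_map (measurable_sum_sq p).aemeasurable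

/-- The law of a scaled chi-square variable, through its density with respect to the chi-square
law. -/
lemma chiSq_preimage_mul {p : ℕ} {c : ℝ} (hc : 0 < c) {A : Set ℝ} (hA : MeasurableSet A) :
    chiSq p ((c ^ 2 * ·) ⁻¹' A)
      = ∫⁻ x in A, ENNReal.ofReal (c⁻¹ ^ p * Real.exp ((1 - (c ^ 2)⁻¹) / 2 * x)) ∂chiSq p := by
  have hm := measurable_sum_sq p
  have hA' : MeasurableSet ((fun g : Fin p → ℝ => ∑ i, g i ^ 2) ⁻¹' A) := hm hA
  have : IsProbabilityMeasure ((gaussianReal 0 1).withDensity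
      fun x => ENNReal.ofReal (gaussianScaleDensity c x)) := by
    rw [← gaussianReal_map_mul_eq_withDensity hc]
    exact Measure.isProbabilityMeasure_map (by fun_prop)
  have : IsProbabilityMeasure ((gaussianReal 0 1).map (c * ·)) :=
    Measure.isProbabilityMeasure_map (by fun_prop)
  rw [chiSq, setLIntegral_map hA (by fun_prop) hm, Measure.map_apply hm (hA.preimage (by fun_prop)),
    ← Set.preimage_comp]
  -- Scaling the Gaussian vector by `c` scales its sum of squares by `c²`, and the product density
  -- depends on the vector only through that sum. So it descends to the chi-square law.
  have h1 : ((c ^ 2 * ·) ∘ fun g : Fin p → ℝ => ∑ i, g i ^ 2) ⁻¹' A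
      = (fun g : Fin p → ℝ => fun i => c * g i) ⁻¹' ((fun g => ∑ i, g i ^ 2) ⁻¹' A) := by
    ext g; simp [mul_pow, Finset.mul_sum]
  rw [h1, ← Measure.map_apply (by fun_prop) hA',
    Measure.pi_map_pi (f := fun _ x => c * x) (fun _ => by fun_prop),
    gaussianReal_map_mul_eq_withDensity hc,
    pi_withDensity _ _ (measurable_gaussianScaleDensity c).ennreal_ofReal, withDensity_apply _ hA']
  refine lintegral_congr fun g => ?_
  rw [← ENNReal.ofReal_prod_of_nonneg fun i _ => by unfold gaussianScaleDensity; positivity]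
  simp only [gaussianScaleDensity, Finset.prod_mul_distrib, Finset.prod_const, Finset.card_univ,
    Fintype.card_fin, ← Real.exp_sum, Finset.mul_sum]

/-- Chernoff's bound for both tails of the chi-square law. -/
lemma chiSq_le_of_exponent {p : ℕ} {c : ℝ} (hc : 0 < c) {A : Set ℝ} (hA : MeasurableSet A)
    {u : ℝ} (h : ∀ x ∈ A, u ≤ (1 - (c ^ 2)⁻¹) / 2 * x) :
    chiSq p A ≤ ENNReal.ofReal (c ^ p * Real.exp (-u)) := by
  -- The density of the scaled law is at least this constant on `A`, and its integral over `A` is a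
  -- probability.
  have h1 : ENNReal.ofReal (c⁻¹ ^ p * Real.exp u) * chiSq p A ≤ 1 := by
    calc _ = ∫⁻ _ in A, ENNReal.ofReal (c⁻¹ ^ p * Real.exp u) ∂chiSq p := by simp
      _ ≤ _ := setLIntegral_mono' hA fun x hx => ENNReal.ofReal_le_ofReal <|
          mul_le_mul_of_nonneg_left (Real.exp_le_exp.2 (h x hx)) (by positivity)
      _ = _ := (chiSq_preimage_mul hc hA).symm
      _ ≤ 1 := prob_le_one
  have h2 : ENNReal.ofReal (c ^ p * Real.exp (-u)) * ENNReal.ofReal (c⁻¹ ^ p * Real.exp u) = 1 := by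
    rw [← ENNReal.ofReal_mul (by positivity), Real.exp_neg]
    have : c ^ p * (Real.exp u)⁻¹ * (c⁻¹ ^ p * Real.exp u) = 1 := by
      rw [inv_pow]; field_simp
    rw [this, ENNReal.ofReal_one]
  calc chiSq p A = ENNReal.ofReal (c ^ p * Real.exp (-u)) *
        (ENNReal.ofReal (c⁻¹ ^ p * Real.exp u) * chiSq p A) := by rw [← mul_assoc, h2, one_mul]
    _ ≤ ENNReal.ofReal (c ^ p * Real.exp (-u)) * 1 := by gcongr
    _ = _ := mul_one _

lemma two_pow_half_le (p : ℕ) : √2 ^ p ≤ Real.exp ((p : ℝ) / 2) := by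
  have h : √2 ≤ Real.exp (1 / 2) := by
    rw [Real.sqrt_le_left (by positivity), ← Real.exp_nat_mul]
    have := Real.add_one_le_exp (1 : ℝ)
    norm_num at this ⊢; linarith
  calc √2 ^ p ≤ Real.exp (1 / 2) ^ p := pow_le_pow_left₀ (by positivity) h p
    _ = _ := by rw [← Real.exp_nat_mul]; congr 1; ring

/-- The choice `c² = 2` gives the rate `(1 - 1/2)/2 = 1/4`; the factor `2^(p/2)` is absorbed by
`e^(p/2)`. -/
lemma chiSq_Ici_le (p : ℕ) (x : ℝ) :
    chiSq p (Set.Ici x) ≤ ENNReal.ofReal (Real.exp (p / 2 - x / 4)) := by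
  refine (chiSq_le_of_exponent (c := √2) (by positivity) measurableSet_Ici (u := x / 4) ?_).trans ?_
  · intro y hy
    rw [Set.mem_Ici] at hy
    norm_num; linarith
  · rw [sub_eq_add_neg, Real.exp_add]
    gcongr
    exact two_pow_half_le p

/-- The choice `c² = 1/(1 + 2s)` gives the rate `-s`, and `log (1 + 2s) ≥ 2s - 2s²` controls the
factor `cⁿ`. -/
lemma chiSq_Iic_le (n : ℕ) {s : ℝ} (hs : 0 ≤ s) (x : ℝ) :
    chiSq n (Set.Iic x) ≤ ENNReal.ofReal (Real.exp (s * (x - n) + s ^ 2 * n)) := by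
  have hc2 : (√(1 + 2 * s))⁻¹ ^ 2 = (1 + 2 * s)⁻¹ := by
    rw [inv_pow, Real.sq_sqrt (by positivity)]
  refine (chiSq_le_of_exponent (c := (√(1 + 2 * s))⁻¹) (by positivity) measurableSet_Iic
    (u := -(s * x)) ?_).trans ?_
  · intro y hy
    rw [Set.mem_Iic] at hy
    rw [hc2, inv_inv]
    nlinarith
  · have h : (√(1 + 2 * s))⁻¹ ≤ Real.exp (s ^ 2 - s) := by
      refine (sq_le_sq₀ (by positivity) (by positivity)).1 ?_
      rw [hc2, ← Real.exp_nat_mul, inv_le_comm₀ (by positivity) (by positivity), ← Real.exp_neg,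
        ← Real.le_log_iff_exp_le (by positivity)]
      refine le_trans ?_ (Real.le_log_one_add_of_nonneg (x := 2 * s) (by positivity))
      rw [le_div_iff₀ (by positivity)]
      push_cast
      nlinarith [pow_nonneg hs 3]
    rw [neg_neg]
    refine ENNReal.ofReal_le_ofReal ?_
    calc (√(1 + 2 * s))⁻¹ ^ n * Real.exp (s * x) ≤ Real.exp (s ^ 2 - s) ^ n * Real.exp (s * x) := by
          gcongr
      _ = _ := by rw [← Real.exp_nat_mul, ← Real.exp_add]; congr 1; ring

/-- Scaling a chi-square variable increases its tail probabilities by a bounded factor, up to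
the probability of very large values. -/
lemma chiSq_scale_le {p : ℕ} {κ X B : ℝ} (hκ : 1 ≤ κ) (hκ2 : κ ≤ 2) (hX : 0 ≤ X)
    (hB : (κ - 1) * X ≤ 2 * B) {A : Set ℝ} (hA : MeasurableSet A) :
    chiSq p ((κ * ·) ⁻¹' A)
      ≤ ENNReal.ofReal (Real.exp B) * chiSq p A + ENNReal.ofReal (Real.exp (p / 2 - X / 8)) := by
  have hκ0 : 0 < κ := by linarith
  -- Below `X` the density ratio is at most `e^B`. Above `X`, `κ ≤ 2` forces the unscaled variable
  -- beyond `X / 2`, a Chernoff tail.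
  have hsplit : (κ * ·) ⁻¹' A ⊆ (κ * ·) ⁻¹' (A ∩ Set.Iio X) ∪ Set.Ici (X / 2) := by
    intro x hx
    by_cases h : κ * x < X
    · exact Or.inl ⟨hx, h⟩
    · refine Or.inr ?_
      rw [Set.mem_Ici]
      nlinarith
  refine (measure_mono hsplit).trans ((measure_union_le _ _).trans (add_le_add ?_ ?_))
  · have hA' : MeasurableSet (A ∩ Set.Iio X) := hA.inter measurableSet_Iio
    have h := chiSq_preimage_mul (p := p) (Real.sqrt_pos.2 hκ0) hA'
    rw [Real.sq_sqrt hκ0.le] at h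
    rw [h]
    have hinv : κ⁻¹ ≤ 1 := inv_le_one_of_one_le₀ hκ
    have hinv' : 1 - κ⁻¹ ≤ κ - 1 := by
      have : κ * κ⁻¹ = 1 := mul_inv_cancel₀ hκ0.ne'
      nlinarith
    calc _ ≤ ∫⁻ _ in A ∩ Set.Iio X, ENNReal.ofReal (Real.exp B) ∂chiSq p := by
          refine setLIntegral_mono' hA' fun x hx => ENNReal.ofReal_le_ofReal ?_
          have h1 : (√κ)⁻¹ ^ p ≤ 1 := pow_le_one₀ (by positivity)
            (inv_le_one_of_one_le₀ (Real.one_le_sqrt.2 hκ))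
          have h2 : (1 - κ⁻¹) / 2 * x ≤ B := by
            have : x < X := hx.2
            nlinarith [mul_le_mul_of_nonneg_right hinv' hX,
              mul_le_mul_of_nonneg_left this.le (sub_nonneg.2 hinv)]
          calc _ ≤ 1 * Real.exp B :=
                mul_le_mul h1 (Real.exp_le_exp.2 h2) (Real.exp_nonneg _) zero_le_one
            _ = _ := one_mul _
      _ = ENNReal.ofReal (Real.exp B) * chiSq p (A ∩ Set.Iio X) := by simp
      _ ≤ _ := by gcongr; exact Set.inter_subset_left
  · refine (chiSq_Ici_le p _).trans (le_of_eq ?_)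
    congr 3; ring

lemma one_sub_cdf_eq (p : ℕ) (x : ℝ) :
    ENNReal.ofReal (1 - cdf (chiSq p) x) = chiSq p (Set.Ioi x) := by
  rw [cdf_eq_real, ← probReal_compl_eq_one_sub measurableSet_Iic, Set.compl_Iic,
    ofReal_measureReal]

/-- A vanishing sum of squares forces a Gaussian coordinate to vanish. For `p = 0` the law is the
point mass at `0`, hence the hypothesis. -/
lemma chiSq_Iic_zero {p : ℕ} (hp : 0 < p) : chiSq p (Set.Iic 0) = 0 := by
  rw [chiSq, Measure.map_apply (measurable_sum_sq p) measurableSet_Iic]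
  have hsub : (fun g : Fin p → ℝ => ∑ i, g i ^ 2) ⁻¹' Set.Iic 0
      ⊆ Function.eval (⟨0, hp⟩ : Fin p) ⁻¹' {0} := by
    intro g hg
    have h0 : g ⟨0, hp⟩ ^ 2 ≤ ∑ i, g i ^ 2 :=
      Finset.single_le_sum (f := fun i => g i ^ 2) (fun i _ => sq_nonneg _) (Finset.mem_univ _)
    have : g ⟨0, hp⟩ ^ 2 ≤ 0 := h0.trans hg
    simpa using pow_eq_zero_iff two_ne_zero |>.1 (le_antisymm this (sq_nonneg _))
  refine measure_mono_null hsub ?_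
  rw [(measurePreserving_eval _ _).measure_preimage (measurableSet_singleton 0).nullMeasurableSet]
  have := nullSingletonClass_gaussianReal (μ := 0) (v := 1) one_ne_zero
  exact measure_singleton 0

/-- The p-value of a slightly inflated chi-square variable is at most `t` with probability of
order `t`. -/
lemma chiSq_one_sub_cdf_le {p : ℕ} (hp : 0 < p) {κ κ' X B t : ℝ} (hκ : 1 ≤ κ) (hκκ' : κ < κ')
    (hκ2 : κ' ≤ 2) (hX : 0 ≤ X) (hB0 : 0 ≤ B) (hB : (κ' - 1) * X ≤ 2 * B) :
    chiSq p {x | 1 - cdf (chiSq p) (κ * x) ≤ t}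
      ≤ ENNReal.ofReal (Real.exp B) * ENNReal.ofReal t
        + ENNReal.ofReal (Real.exp (p / 2 - X / 8)) := by
  set S : Set ℝ := {x | 1 - cdf (chiSq p) (κ * x) ≤ t} with hS
  set R := ENNReal.ofReal (Real.exp B) * ENNReal.ofReal t
        + ENNReal.ofReal (Real.exp (p / 2 - X / 8)) with hR
  have hκ0 : 0 < κ := by linarith
  rcases le_or_gt 1 t with ht | ht
  · calc chiSq p S ≤ 1 := prob_le_one
      _ ≤ ENNReal.ofReal (Real.exp B) * ENNReal.ofReal t := by
        rw [← ENNReal.ofReal_mul (Real.exp_nonneg _), ENNReal.one_le_ofReal]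
        nlinarith [Real.one_le_exp hB0]
      _ ≤ R := le_self_add
  -- At nonpositive points the p-value is 1, which exceeds `t`.
  have hpos : ∀ x ∈ S, 0 < x := by
    intro x hx
    by_contra! h
    have h0 : cdf (chiSq p) (κ * x) = 0 := by
      rw [cdf_eq_real, measureReal_def,
        measure_mono_null (Set.Iic_subset_Iic.2 (by nlinarith)) (chiSq_Iic_zero hp)]
      rfl
    rw [hS, Set.mem_ofPred_eq, h0] at hx
    linarith
  have hup : ∀ x ∈ S, ∀ y, x ≤ y → y ∈ S := by
    intro x hx y hxy
    have := monotone_cdf (chiSq p) (mul_le_mul_of_nonneg_left hxy hκ0.le)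
    have hx' : 1 - cdf (chiSq p) (κ * x) ≤ t := hx
    change 1 - cdf (chiSq p) (κ * y) ≤ t
    linarith
  have hmain : ∀ x ∈ S, chiSq p (Set.Ici x) ≤ R := by
    intro x hx
    -- The strict inequality `κ < κ'` puts the endpoint `x` into the open tail, so no continuity of
    -- the distribution function is needed.
    have hsub : Set.Ici x ⊆ (κ' * ·) ⁻¹' Set.Ioi (κ * x) := by
      intro y hy
      have hx0 := hpos x hx
      have hy' : x ≤ y := hy
      change κ * x < κ' * y
      nlinarith
    refine (measure_mono hsub).trans
      ((chiSq_scale_le (by linarith) hκ2 hX hB measurableSet_Ioi).trans ?_)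
    rw [← one_sub_cdf_eq]
    exact add_le_add (mul_le_mul_right (ENNReal.ofReal_le_ofReal hx) _) le_rfl
  rcases S.eq_empty_or_nonempty with he | hne
  · simp [he]
  have hbdd : BddBelow S := ⟨0, fun x hx => (hpos x hx).le⟩
  obtain ⟨u, hu_anti, hu_lim, hu_mem⟩ := exists_seq_tendsto_sInf hne hbdd
  by_cases ha : sInf S ∈ S
  · exact (measure_mono fun x hx => csInf_le hbdd hx).trans (hmain _ ha)
  · have hcov : S ⊆ ⋃ n, Set.Ici (u n) := by
      intro x hx
      have hlt : sInf S < x := lt_of_le_of_ne (csInf_le hbdd hx) fun h => ha (h ▸ hx)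
      obtain ⟨n, hn⟩ := (hu_lim.eventually_lt_const hlt).exists
      exact Set.mem_iUnion.2 ⟨n, hn.le⟩
    refine (measure_mono hcov).trans ?_
    have hmono : Monotone fun n => Set.Ici (u n) := fun i j hij =>
      Set.Ici_subset_Ici.2 (hu_anti hij)
    rw [hmono.measure_iUnion]
    exact iSup_le fun n => hmain _ (hu_mem n)

/-! ### Projections of Gaussian noise -/

/-- For `t ∈ V` the inner products of `t` with `x` and with its projection agree, so the
characteristic functions coincide. -/
lemma map_orthogonalProjection_stdGaussian {E : Type*} [NormedAddCommGroup E]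
    [InnerProductSpace ℝ E] [FiniteDimensional ℝ E] [MeasurableSpace E] [BorelSpace E]
    (V : Submodule ℝ E) :
    (stdGaussian E).map V.orthogonalProjectionOnto = stdGaussian V := by
  refine Measure.ext_of_charFun (funext fun t => ?_)
  rw [charFun_stdGaussian, charFun_apply, integral_map (by fun_prop) (by fun_prop)]
  have h := charFun_stdGaussian (E := E) (t : E)
  rw [charFun_apply] at h
  refine Eq.trans ?_ h
  refine integral_congr_ae (Eventually.of_forall fun x => ?_)
  have hx : inner ℝ (V.orthogonalProjectionOnto x) t = inner ℝ x (t : E) :=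
    Submodule.inner_orthogonalProjectionOnto_eq_of_mem_right t x
  simp only [hx]

lemma map_norm_sq_stdGaussian (E : Type*) [NormedAddCommGroup E]
    [InnerProductSpace ℝ E] [FiniteDimensional ℝ E] [MeasurableSpace E] [BorelSpace E] :
    (stdGaussian E).map (fun x => ‖x‖ ^ 2) = chiSq (Module.finrank ℝ E) := by
  rw [stdGaussian, Measure.map_map (by fun_prop) (by fun_prop), chiSq]
  congr 1 with g
  have h := (stdOrthonormalBasis ℝ E).repr.symm.norm_map (WithLp.toLp 2 g)
  rw [← (stdOrthonormalBasis ℝ E).sum_repr_symm] at h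
  simp only [Function.comp_apply]
  rw [h, EuclideanSpace.real_norm_sq_eq]

lemma map_starProjection_stdGaussian {E : Type*} [NormedAddCommGroup E]
    [InnerProductSpace ℝ E] [FiniteDimensional ℝ E] [MeasurableSpace E] [BorelSpace E]
    (V : Submodule ℝ E) :
    (stdGaussian E).map (fun x => ‖V.starProjection x‖ ^ 2) = chiSq (Module.finrank ℝ V) := by
  rw [← map_norm_sq_stdGaussian, ← map_orthogonalProjection_stdGaussian,
    Measure.map_map (by fun_prop) (by fun_prop)]
  rfl

lemma hasLaw_starProjection_noise {Ω : Type*} [MeasurableSpace Ω] {μ : Measure Ω}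
    [IsProbabilityMeasure μ] {n : ℕ} {σ2 : NNReal} (hσ2 : σ2 ≠ 0) {ε : Fin n → Ω → ℝ}
    (hindep : iIndepFun ε μ) (hlaw : ∀ i, HasLaw (ε i) (gaussianReal 0 σ2) μ)
    (V : Submodule ℝ (EuclideanSpace ℝ (Fin n))) :
    HasLaw (fun ω => ‖V.starProjection (WithLp.toLp 2 fun i => ε i ω)‖ ^ 2 / σ2)
      (chiSq (Module.finrank ℝ V)) μ := by
  have hσ : 0 < (σ2 : ℝ) := by positivity
  have h1 : ∀ i, HasLaw (fun ω => ε i ω / √σ2) (gaussianReal 0 1) μ := by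
    intro i
    have h := ProbabilityTheory.gaussianReal_div_const (hlaw i) (√σ2)
    convert h using 2
    · simp
    · ext
      rw [NNReal.coe_div, NNReal.coe_mk, Real.sq_sqrt hσ.le, div_self hσ.ne', NNReal.coe_one]
  have h2 : iIndepFun (fun i ω => ε i ω / √σ2) μ :=
    hindep.comp (fun _ x => x / √σ2) fun _ => by fun_prop
  have h3 := h2.hasLaw_pi h1
  have h4 : HasLaw (fun g : Fin n → ℝ => ‖V.starProjection (WithLp.toLp 2 g)‖ ^ 2)
      (chiSq (Module.finrank ℝ V)) (Measure.pi fun _ : Fin n => gaussianReal 0 1) := by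
    refine ⟨by fun_prop, ?_⟩
    rw [← map_starProjection_stdGaussian, ← map_pi_eq_stdGaussian,
      Measure.map_map (by fun_prop) (by fun_prop)]
    rfl
  have h5 := h4.comp h3
  convert h5 using 1
  ext ω
  have : (WithLp.toLp 2 fun i => ε i ω / √σ2 : EuclideanSpace ℝ (Fin n))
      = (√σ2)⁻¹ • WithLp.toLp 2 fun i => ε i ω := by
    ext i; simp [div_eq_inv_mul]
  simp only [Function.comp_def]
  rw [this, map_smul, norm_smul, mul_pow, Real.norm_eq_abs, sq_abs, inv_pow, Real.sq_sqrt hσ.le,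
    div_eq_inv_mul]

lemma measure_mem_eq_of_hasLaw {Ω : Type*} [MeasurableSpace Ω] {μ : Measure Ω} {X : Ω → ℝ} {ν : Measure ℝ}
    (h : HasLaw X ν μ) {A : Set ℝ} (hA : MeasurableSet A) : μ {ω | X ω ∈ A} = ν A := by
  rw [← h.map_eq, Measure.map_apply_of_aemeasurable h.aemeasurable hA]
  rfl

/-! ### Residual sums of squares of nested spaces -/

variable {n : ℕ}

lemma rss_eq_norm_sq_sub (V : Submodule ℝ (EuclideanSpace ℝ (Fin n)))
    (y : EuclideanSpace ℝ (Fin n)) : rss V y = ‖y‖ ^ 2 - ‖V.starProjection y‖ ^ 2 := by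
  rw [rss, V.norm_sq_eq_add_norm_sq_starProjection y, Submodule.starProjection_orthogonal_val]
  ring

lemma rss_add_of_mem {V : Submodule ℝ (EuclideanSpace ℝ (Fin n))}
    {m : EuclideanSpace ℝ (Fin n)} (hm : m ∈ V) (e : EuclideanSpace ℝ (Fin n)) :
    rss V (m + e) = rss V e := by
  rw [rss, rss, map_add, Submodule.starProjection_eq_self_iff.2 hm, add_sub_add_left_eq_sub]

/-- `V` is the orthogonal sum of `U` and `Uᗮ ⊓ V`; by Pythagoras the drop in RSS is then a squared
projection. -/
lemma starProjection_add_orthogonal_inf {U V : Submodule ℝ (EuclideanSpace ℝ (Fin n))}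
    (h : U ≤ V) (y : EuclideanSpace ℝ (Fin n)) :
    V.starProjection y = U.starProjection y + (Uᗮ ⊓ V).starProjection y := by
  refine Submodule.eq_starProjection_of_mem_of_inner_eq_zero
    (V.add_mem (h (U.starProjection_apply_mem y))
      (Submodule.starProjection_apply_mem (Uᗮ ⊓ V) y).2) fun v hv => ?_
  set u := U.starProjection y
  set w := (Uᗮ ⊓ V).starProjection y
  have hu : u ∈ U := U.starProjection_apply_mem y
  have hw : w ∈ Uᗮ ⊓ V := Submodule.starProjection_apply_mem (Uᗮ ⊓ V) y
  have hv1 : U.starProjection v ∈ U := U.starProjection_apply_mem v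
  have hv2 : v - U.starProjection v ∈ Uᗮ ⊓ V :=
    ⟨U.sub_starProjection_mem_orthogonal v, V.sub_mem hv (h hv1)⟩
  have e1 : inner ℝ (y - u) (U.starProjection v) = 0 := U.starProjection_inner_eq_zero y _ hv1
  have e2 : inner ℝ w (U.starProjection v) = 0 := Submodule.inner_left_of_mem_orthogonal hv1 hw.1
  have e3 : inner ℝ (y - w) (v - U.starProjection v) = 0 :=
    Submodule.starProjection_inner_eq_zero (K := Uᗮ ⊓ V) y _ hv2
  have e4 : inner ℝ u (v - U.starProjection v) = 0 :=
    Submodule.inner_right_of_mem_orthogonal hu hv2.1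
  have : inner ℝ (y - (u + w)) v
      = inner ℝ (y - u) (U.starProjection v) - inner ℝ w (U.starProjection v)
        + (inner ℝ (y - w) (v - U.starProjection v) - inner ℝ u (v - U.starProjection v)) := by
    simp only [inner_sub_left, inner_sub_right, inner_add_left]
    ring
  rw [this, e1, e2, e3, e4]
  ring

lemma rss_sub_rss {U V : Submodule ℝ (EuclideanSpace ℝ (Fin n))} (h : U ≤ V)
    (y : EuclideanSpace ℝ (Fin n)) : rss U y - rss V y = ‖(Uᗮ ⊓ V).starProjection y‖ ^ 2 := by
  have horth : inner ℝ (U.starProjection y) ((Uᗮ ⊓ V).starProjection y) = 0 :=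
    Submodule.inner_right_of_mem_orthogonal (U.starProjection_apply_mem y)
      (Submodule.starProjection_apply_mem (Uᗮ ⊓ V) y).1
  rw [rss_eq_norm_sq_sub, rss_eq_norm_sq_sub, starProjection_add_orthogonal_inf h,
    norm_add_sq_real, horth]
  ring

/-- The squared norm of a projected vector is at least a quarter of the bound for its mean, if
the noise is small enough. -/
lemma le_norm_starProjection_add_sq (V : Submodule ℝ (EuclideanSpace ℝ (Fin n)))
    {m e : EuclideanSpace ℝ (Fin n)} {a : ℝ} (ha : 0 ≤ a) (hm : a ≤ ‖V.starProjection m‖ ^ 2)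
    (he : ‖V.starProjection e‖ ^ 2 ≤ a / 4) : a / 4 ≤ ‖V.starProjection (m + e)‖ ^ 2 := by
  have h1 : √a ≤ ‖V.starProjection m‖ := Real.sqrt_le_left (norm_nonneg _) |>.2 hm
  have h2 : ‖V.starProjection e‖ ≤ √a / 2 := by
    refine (sq_le_sq₀ (norm_nonneg _) (by positivity)).1 (he.trans_eq ?_)
    rw [div_pow, Real.sq_sqrt ha]; norm_num
  have h3 : √a / 2 ≤ ‖V.starProjection (m + e)‖ := by
    rw [map_add]
    have := norm_sub_norm_le (V.starProjection m) (-V.starProjection e)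
    rw [norm_neg, sub_neg_eq_add] at this
    linarith
  calc a / 4 = (√a / 2) ^ 2 := by rw [div_pow, Real.sq_sqrt ha]; norm_num
    _ ≤ _ := pow_le_pow_left₀ (by positivity) h3 2

lemma norm_starProjection_mono {U V : Submodule ℝ (EuclideanSpace ℝ (Fin n))} (h : U ≤ V)
    (y : EuclideanSpace ℝ (Fin n)) : ‖U.starProjection y‖ ≤ ‖V.starProjection y‖ := by
  have : U.starProjection y = U.starProjection (V.starProjection y) := by
    rw [U.starProjection_apply, U.starProjection_apply,
      Submodule.orthogonalProjectionOnto_starProjection_of_le h]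
  rw [this]
  exact U.norm_starProjection_apply_le _

/-! ### Reduction of the functional model to a linear one -/

lemma measurable_bspline (τ : ℕ → ℝ) (d j : ℕ) : Measurable (bspline τ d j) := by
  induction d generalizing j with
  | zero =>
    change Measurable fun t => if τ j ≤ t ∧ t < τ (j + 1) then (1 : ℝ) else 0
    exact Measurable.ite (measurableSet_Ici.inter measurableSet_Iio) measurable_const
      measurable_const
  | succ d ih =>
    have h1 := ih j
    have h2 := ih (j + 1)
    change Measurable fun t => (t - τ j) / (τ (j + d + 1) - τ j) * bspline τ d j t
        + (τ (j + d + 2) - t) / (τ (j + d + 2) - τ (j + 1)) * bspline τ d (j + 1) t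
    fun_prop

/-- The coefficients of the recursion are affine, hence bounded on a compact set. Boundedness makes
the products of basis functions integrable. -/
lemma exists_bspline_bound (τ : ℕ → ℝ) (d j : ℕ) {T : Set ℝ} (hT : IsCompact T) :
    ∃ C, ∀ t ∈ T, ‖bspline τ d j t‖ ≤ C := by
  induction d generalizing j with
  | zero =>
    refine ⟨1, fun t _ => ?_⟩
    unfold bspline
    split_ifs <;> simp
  | succ d ih =>
    obtain ⟨C₁, h₁⟩ := ih j
    obtain ⟨C₂, h₂⟩ := ih (j + 1)
    obtain ⟨K₁, k₁⟩ := hT.exists_bound_of_continuousOn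
      (f := fun t => (t - τ j) / (τ (j + d + 1) - τ j)) (by fun_prop)
    obtain ⟨K₂, k₂⟩ := hT.exists_bound_of_continuousOn
      (f := fun t => (τ (j + d + 2) - t) / (τ (j + d + 2) - τ (j + 1))) (by fun_prop)
    refine ⟨K₁ * C₁ + K₂ * C₂, fun t ht => ?_⟩
    unfold bspline
    refine (norm_add_le _ _).trans ?_
    rw [norm_mul, norm_mul]
    exact add_le_add
      (mul_le_mul (k₁ t ht) (h₁ t ht) (norm_nonneg _) ((norm_nonneg _).trans (k₁ t ht)))
      (mul_le_mul (k₂ t ht) (h₂ t ht) (norm_nonneg _) ((norm_nonneg _).trans (k₂ t ht)))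

namespace Model

variable {n : ℕ} (D : Model n)

lemma integrableOn_φ_mul_φ (m : Fin D.M) (l j : Fin (D.p m)) :
    IntegrableOn (fun t => D.φ m l t * D.φ m j t) (D.T m) := by
  obtain ⟨C₁, h₁⟩ := exists_bspline_bound (D.knots m) (D.deg m) l (D.T_compact m)
  obtain ⟨C₂, h₂⟩ := exists_bspline_bound (D.knots m) (D.deg m) j (D.T_compact m)
  refine IntegrableOn.of_bound (C := C₁ * C₂) (D.T_compact m).measure_lt_top
    ((measurable_bspline _ _ _).mul (measurable_bspline _ _ _)).aestronglyMeasurable ?_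
  refine (ae_restrict_iff' (D.T_compact m).measurableSet).2 (Eventually.of_forall fun t ht => ?_)
  rw [norm_mul]
  exact mul_le_mul (h₁ t ht) (h₂ t ht) (norm_nonneg _) ((norm_nonneg _).trans (h₁ t ht))

/-- Bilinearity of the integral turns the functional term into a combination of columns of `Z`.
Beyond this point the splines play no role. -/
lemma integral_x_mul_coeffFun (a : (m : Fin D.M) → Fin (D.p m) → ℝ) (i : Fin n) (m : Fin D.M) :
    ∫ t in D.T m, D.x i m t * D.coeffFun a m t = ∑ j, a m j * D.Z i (Sum.inr ⟨m, j⟩) := by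
  have h : ∀ t, D.x i m t * D.coeffFun a m t
      = ∑ j, ∑ l, (a m j * D.W i m l) * (D.φ m l t * D.φ m j t) := by
    intro t
    rw [x, coeffFun, Finset.sum_mul_sum, Finset.sum_comm]
    exact Finset.sum_congr rfl fun j _ => Finset.sum_congr rfl fun l _ => by ring
  simp_rw [h]
  rw [integral_finsetSum _ fun j _ => integrable_finsetSum _ fun l _ =>
    (D.integrableOn_φ_mul_φ m l j).const_mul _]
  refine Finset.sum_congr rfl fun j _ => ?_
  rw [integral_finsetSum _ fun l _ => (D.integrableOn_φ_mul_φ m l j).const_mul _]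
  simp only [integral_const_mul, Z, Matrix.vecMul, dotProduct, J, Finset.mul_sum, mul_assoc]

/-- The vector of the regression function values at the observations. -/
noncomputable def signal (a₀ : ℝ) (a : (m : Fin D.M) → Fin (D.p m) → ℝ) : EuclideanSpace ℝ (Fin n) :=
  WithLp.toLp 2 fun i => D.regression a₀ a i

lemma signal_eq (a₀ : ℝ) (a : (m : Fin D.M) → Fin (D.p m) → ℝ) :
    D.signal a₀ a = a₀ • D.column (Sum.inl ())
      + ∑ m, ∑ j, a m j • D.column (Sum.inr ⟨m, j⟩) := by
  ext i
  simp [signal, regression, integral_x_mul_coeffFun, column, Z]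

lemma response_eq (e : Fin n → ℝ) : D.response e = D.signal D.β₀ D.b + WithLp.toLp 2 e := rfl

lemma norm_signal_sq (a₀ : ℝ) (a : (m : Fin D.M) → Fin (D.p m) → ℝ) :
    ‖D.signal a₀ a‖ ^ 2 = ∑ i, D.regression a₀ a i ^ 2 :=
  EuclideanSpace.real_norm_sq_eq _

lemma column_mem_fullSpace (c : D.Param) : D.column c ∈ D.fullSpace :=
  Submodule.subset_span ⟨c, rfl⟩

lemma nullSpace_le_fullSpace (r : Fin D.M) : D.nullSpace r ≤ D.fullSpace :=
  Submodule.span_mono (Set.image_subset_range _ _)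

lemma signal_mem_fullSpace (a₀ : ℝ) (a : (m : Fin D.M) → Fin (D.p m) → ℝ) :
    D.signal a₀ a ∈ D.fullSpace := by
  rw [signal_eq]
  exact add_mem (Submodule.smul_mem _ _ (D.column_mem_fullSpace _))
    (sum_mem fun m _ => sum_mem fun j _ => Submodule.smul_mem _ _ (D.column_mem_fullSpace _))

lemma signal_mem_nullSpace {r : Fin D.M} (a₀ : ℝ) {a : (m : Fin D.M) → Fin (D.p m) → ℝ}
    (ha : a r = 0) : D.signal a₀ a ∈ D.nullSpace r := by
  rw [signal_eq]
  refine add_mem (Submodule.smul_mem _ _ (Submodule.subset_span ⟨_, by simp, rfl⟩))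
    (sum_mem fun m _ => sum_mem fun j _ => ?_)
  by_cases hm : m = r
  · subst hm
    simp [ha]
  · refine Submodule.smul_mem _ _ (Submodule.subset_span ⟨_, fun j' h => hm ?_, rfl⟩)
    simp only [Sum.inr.injEq, Sigma.mk.injEq] at h
    exact h.1

/-- Lets the null fit be subtracted from the true signal as a model with zero `r`-block: the
residual keeps the block `b r`, so the design condition applies to it. -/
lemma exists_signal_eq_of_mem_nullSpace {r : Fin D.M} {v : EuclideanSpace ℝ (Fin n)}
    (hv : v ∈ D.nullSpace r) :
    ∃ (a₀ : ℝ) (a : (m : Fin D.M) → Fin (D.p m) → ℝ), a r = 0 ∧ D.signal a₀ a = v := by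
  induction hv using Submodule.span_induction with
  | mem v hv =>
    obtain ⟨c, hc, rfl⟩ := hv
    rcases c with ⟨⟩ | ⟨m, j⟩
    · exact ⟨1, 0, rfl, by simp [signal_eq]⟩
    · have hm : r ≠ m := by
        rintro rfl
        exact hc j rfl
      refine ⟨0, Pi.single m (Pi.single j 1), Pi.single_eq_of_ne hm _, ?_⟩
      rw [signal_eq, zero_smul, zero_add, Finset.sum_eq_single m, Finset.sum_eq_single j]
      · simp
      · intro j' _ h; simp [h]
      · simp
      · intro m' _ h; simp [h]
      · simp
  | zero => exact ⟨0, 0, rfl, by simp [signal_eq]⟩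
  | add v w _ _ hv hw =>
    obtain ⟨a₀, a, ha, rfl⟩ := hv
    obtain ⟨a₀', a', ha', rfl⟩ := hw
    refine ⟨a₀ + a₀', a + a', by simp [ha, ha'], ?_⟩
    simp only [signal_eq, Pi.add_apply, add_smul, Finset.sum_add_distrib]
    abel
  | smul s v _ hv =>
    obtain ⟨a₀, a, ha, rfl⟩ := hv
    refine ⟨s * a₀, s • a, by simp [ha], ?_⟩
    simp only [signal_eq, Pi.smul_apply, smul_eq_mul, mul_smul, Finset.smul_sum, smul_add]

lemma signal_sub (a₀ a₀' : ℝ) (a a' : (m : Fin D.M) → Fin (D.p m) → ℝ) :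
    D.signal (a₀ - a₀') (a - a') = D.signal a₀ a - D.signal a₀' a' := by
  simp only [signal_eq, Pi.sub_apply, sub_smul, Finset.sum_sub_distrib]
  abel

/-- The space of the contrasts that are tested for the `r`-th predictor. -/
noncomputable def testSpace (r : Fin D.M) : Submodule ℝ (EuclideanSpace ℝ (Fin n)) :=
  (D.nullSpace r)ᗮ ⊓ D.fullSpace

lemma rss_sub_rss (r : Fin D.M) (y : EuclideanSpace ℝ (Fin n)) :
    rss (D.nullSpace r) y - rss D.fullSpace y = ‖(D.testSpace r).starProjection y‖ ^ 2 :=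
  FunReg.rss_sub_rss (D.nullSpace_le_fullSpace r) y

/-- The contribution of a distinguishable predictor to the signal. -/
lemma le_norm_starProjection_signal_sq {r : Fin D.M} {c : ℝ}
    (h : ∀ (a₀ : ℝ) (a : (m : Fin D.M) → Fin (D.p m) → ℝ), a r = D.b r →
      c ≤ ∑ i, D.regression a₀ a i ^ 2) :
    c ≤ ‖(D.testSpace r).starProjection (D.signal D.β₀ D.b)‖ ^ 2 := by
  -- The signal is fitted exactly by the full space, so its squared test projection is its squared
  -- distance from the null space.
  have h0 : rss D.fullSpace (D.signal D.β₀ D.b) = 0 := by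
    rw [rss, Submodule.starProjection_eq_self_iff.2 (D.signal_mem_fullSpace _ _)]
    simp
  rw [← rss_sub_rss, h0, sub_zero, rss]
  obtain ⟨a₀, a, ha, hv⟩ := D.exists_signal_eq_of_mem_nullSpace
    ((D.nullSpace r).starProjection_apply_mem (D.signal D.β₀ D.b))
  rw [← hv, ← signal_sub, norm_signal_sq]
  exact h _ _ (by simp [ha])

lemma finrank_fullSpace (h : LinearIndependent ℝ D.column) :
    Module.finrank ℝ D.fullSpace = D.k := by
  rw [fullSpace, finrank_span_eq_card h]
  simp [k]

lemma finrank_testSpace (h : LinearIndependent ℝ D.column) (r : Fin D.M) :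
    Module.finrank ℝ (D.testSpace r) = D.p r := by
  classical
  refine Submodule.finrank_add_inf_finrank_orthogonal' (D.nullSpace_le_fullSpace r) ?_
  set s : Set D.Param := {c | ∀ j : Fin (D.p r), c ≠ Sum.inr ⟨r, j⟩} with hs
  have h1 : Module.finrank ℝ (D.nullSpace r) = s.ncard := by
    have h2 := finrank_span_eq_card (h.comp (Subtype.val : s → D.Param) Subtype.val_injective)
    rw [Set.range_comp, Subtype.range_coe] at h2
    rw [nullSpace, h2, ← Nat.card_eq_fintype_card, Nat.card_coe_set_eq]
  have h3 : sᶜ = Set.range fun j : Fin (D.p r) => (Sum.inr ⟨r, j⟩ : D.Param) := by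
    ext c
    simp [hs, eq_comm]
  have h4 : (sᶜ).ncard = D.p r := by
    rw [h3, ← Set.image_univ, Set.ncard_image_of_injective, Set.ncard_univ, Nat.card_fin]
    intro j j' hj
    simpa using hj
  rw [h1, D.finrank_fullSpace h, ← h4, Set.ncard_add_ncard_compl, Nat.card_eq_fintype_card]
  simp [k]

lemma p_le_k (r : Fin D.M) : D.p r ≤ D.k :=
  (Finset.single_le_sum (f := D.p) (fun _ _ => Nat.zero_le _) (Finset.mem_univ r)).trans
    (Nat.le_add_left _ _)

lemma M_le_k : D.M ≤ D.k := by
  have : ∑ _ : Fin D.M, 1 ≤ ∑ m, D.p m := Finset.sum_le_sum fun m _ => D.p_pos m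
  simp at this
  unfold k; omega

end Model

/-! ### Deterministic criteria for exact selection -/

lemma bonferroni_eq {M : ℕ} {π : Fin M → ℝ} {q : ℝ} {I : Finset (Fin M)}
    (h1 : ∀ r ∈ I, π r ≤ q / M) (h2 : ∀ r ∉ I, q / M < π r) : bonferroni π q = I := by
  ext r
  simp only [bonferroni, Finset.mem_filter, Finset.mem_univ, true_and]
  exact ⟨fun h => by by_contra hr; exact absurd h (h2 r hr).not_ge, h1 r⟩

/-- The step-up procedure selects `I` if the p-values in `I` pass the threshold for `#I`
rejections and the others do not even pass that for `M` rejections. -/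
lemma benjaminiYekutieli_eq {M : ℕ} {π : Fin M → ℝ} {q : ℝ} {I : Finset (Fin M)} (hq : 0 ≤ q)
    (hI : I.Nonempty)
    (h1 : ∀ r ∈ I, π r ≤ (I.card : ℝ) / M * (q / ∑ l ∈ Finset.Icc 1 M, (l : ℝ)⁻¹))
    (h2 : ∀ r ∉ I, q / ∑ l ∈ Finset.Icc 1 M, (l : ℝ)⁻¹ < π r) :
    benjaminiYekutieli π q = I := by
  set θ := q / ∑ l ∈ Finset.Icc 1 M, (l : ℝ)⁻¹ with hθ
  have hθ0 : 0 ≤ θ := div_nonneg hq (Finset.sum_nonneg fun l _ => by positivity)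
  have hcard : I.card ≤ M := by simpa using I.card_le_univ
  have hM : (0 : ℝ) < M := by
    have := hI.card_pos
    exact_mod_cast this.trans_le hcard
  have hle : ∀ r ∈ I, π r ≤ θ := fun r hr => (h1 r hr).trans <| by
    refine mul_le_of_le_one_left hθ0 ((div_le_one hM).2 ?_)
    exact_mod_cast hcard
  have hmono : Monotone (π ∘ Tuple.sort π) := Tuple.monotone_sort π
  set J : Finset (Fin M) := Finset.univ.filter fun j => Tuple.sort π j ∈ I with hJ
  have hJI : J.image (Tuple.sort π) = I := by
    ext r
    simp only [hJ, Finset.mem_image, Finset.mem_filter, Finset.mem_univ, true_and]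
    exact ⟨fun ⟨j, hj, h⟩ => h ▸ hj, fun hr => ⟨(Tuple.sort π).symm r, by simpa, by simp⟩⟩
  have hJcard : J.card = I.card := by
    rw [← hJI, Finset.card_image_of_injective _ (Tuple.sort π).injective]
  -- The p-values in `I` lie below `θ` and all others above, so `I` occupies an initial segment of
  -- the sorted order.
  have hdown : ∀ j ∈ J, ∀ i ≤ j, i ∈ J := by
    intro j hj i hij
    simp only [hJ, Finset.mem_filter, Finset.mem_univ, true_and] at hj ⊢
    by_contra hi
    exact absurd ((hmono hij).trans (hle _ hj)) (h2 _ hi).not_ge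
  have hJ_iff : ∀ j : Fin M, j ∈ J ↔ (j : ℕ) < I.card := by
    intro j
    constructor
    · intro hj
      have hsub : Finset.Iic j ⊆ J := fun i hi => hdown j hj i (Finset.mem_Iic.1 hi)
      have := Finset.card_le_card hsub
      rw [Fin.card_Iic, hJcard] at this
      omega
    · intro hj
      by_contra hjJ
      have hsub : J ⊆ Finset.Iio j := fun i hi => by
        rw [Finset.mem_Iio]
        by_contra hij
        exact hjJ (hdown i hi j (not_lt.1 hij))
      have := Finset.card_le_card hsub
      rw [Fin.card_Iio, hJcard] at this
      omega
  have hcount : byCount π q = I.card := by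
    apply le_antisymm
    · refine Finset.sup_le fun j hj => ?_
      rw [Finset.mem_filter] at hj
      have hjθ : π (Tuple.sort π j) ≤ θ := hj.2.trans <| by
        refine mul_le_of_le_one_left hθ0 ((div_le_one hM).2 ?_)
        exact_mod_cast j.2
      have hjJ : j ∈ J := by
        simp only [hJ, Finset.mem_filter, Finset.mem_univ, true_and]
        by_contra h
        exact absurd hjθ (h2 _ h).not_ge
      exact (hJ_iff j).1 hjJ
    · have hpos := hI.card_pos
      -- Positions start at 0, so this is the `#I`-th ordered value, whose threshold is that of
      -- `h1`.
      set j : Fin M := ⟨I.card - 1, by omega⟩ with hj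
      have hjc : (j : ℕ) + 1 = I.card := by simp only [hj]; omega
      have hjJ : j ∈ J := (hJ_iff j).2 (by omega)
      rw [← hjc]
      refine Finset.le_sup (f := fun j : Fin M => (j : ℕ) + 1) ?_
      refine Finset.mem_filter.2 ⟨Finset.mem_univ _, ?_⟩
      have hc : ((j : ℕ) : ℝ) + 1 = (I.card : ℝ) := by exact_mod_cast hjc
      rw [hc]
      exact h1 _ (by simpa [hJ] using hjJ)
  rw [benjaminiYekutieli, hcount, ← hJI]
  congr 1
  ext j
  simp [hJ_iff j, hJI]

/-! ### p-values under typical noise -/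

namespace Model

variable {n : ℕ} (D : Model n)

lemma pValue_le_iff (y : EuclideanSpace ℝ (Fin n)) (r : Fin D.M) {t x : ℝ}
    (hx : x ≤ D.lrStat r y) (h : 1 - cdf (chiSq (D.p r)) x ≤ t) : D.pValue y r ≤ t := by
  have := monotone_cdf (chiSq (D.p r)) hx
  rw [pValue]; linarith

/-- The realizations of the noise for which the residual variance is close to its mean and the
projection of the noise to the regression space is small. -/
def TypicalNoise (σ2 : ℝ) (e : EuclideanSpace ℝ (Fin n)) : Prop :=
  ‖D.fullSpace.starProjection e‖ ^ 2 / σ2 < √n ∧ n - √n * Real.log n < ‖e‖ ^ 2 / σ2 ∧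
    ‖e‖ ^ 2 / σ2 < 4 * n

variable {D}

/-- The full fit absorbs `m`, so RSS is `‖e‖² - ‖P e‖²`, at least `σ²(n - 2√n log n)`. With `v = log
n / √n ≤ 1/8` one has `(1 + 4v)(1 - 2v) ≥ 1`. -/
lemma TypicalNoise.rss_pos_and_le {σ2 : ℝ} (hσ2 : 0 < σ2) {e : EuclideanSpace ℝ (Fin n)}
    (he : D.TypicalNoise σ2 e) (hlog : 1 ≤ Real.log n) (hx : 8 * Real.log n ≤ √n)
    {m : EuclideanSpace ℝ (Fin n)} (hm : m ∈ D.fullSpace) :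
    0 < rss D.fullSpace (m + e) / n ∧ rss D.fullSpace (m + e) / n ≤ 4 * σ2 ∧
      σ2 ≤ (1 + 4 * (Real.log n / √n)) * (rss D.fullSpace (m + e) / n) := by
  obtain ⟨h1, h2, h3⟩ := he
  rw [div_lt_iff₀ hσ2] at h1 h3
  rw [lt_div_iff₀ hσ2] at h2
  rw [rss_add_of_mem hm, rss_eq_norm_sq_sub]
  set s := √(n : ℝ) with hs
  have hs0 : 0 < s := by linarith
  have hn : (n : ℝ) = s ^ 2 := (Real.sq_sqrt (Nat.cast_nonneg n)).symm
  set L := Real.log n with hL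
  set R := ‖e‖ ^ 2 - ‖D.fullSpace.starProjection e‖ ^ 2 with hR
  rw [hn] at h2 h3 ⊢
  have hlow : (s ^ 2 - 2 * s * L) * σ2 ≤ R := by
    have : s * 1 * σ2 ≤ s * L * σ2 := by gcongr
    nlinarith
  have hpos : 0 < s ^ 2 - 2 * s * L := by nlinarith
  have hRpos : 0 < R := lt_of_lt_of_le (by positivity) hlow
  refine ⟨by positivity, ?_, ?_⟩
  · rw [div_le_iff₀ (by positivity)]
    have := sq_nonneg ‖D.fullSpace.starProjection e‖
    linarith
  · have h5 : (1 + 4 * (L / s)) * (R / s ^ 2) = (s + 4 * L) * R / s ^ 3 := by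
      field_simp
    rw [h5, le_div_iff₀ (by positivity)]
    have h6 : s ^ 3 ≤ (s + 4 * L) * (s ^ 2 - 2 * s * L) := by
      have : 0 ≤ s * L * (s - 8 * L) := by
        have : 0 ≤ s - 8 * L := by linarith
        positivity
      nlinarith [mul_pos (mul_pos hs0 hs0) (show 0 < L by linarith)]
    calc σ2 * s ^ 3 ≤ σ2 * ((s + 4 * L) * (s ^ 2 - 2 * s * L)) := by gcongr
      _ = (s + 4 * L) * ((s ^ 2 - 2 * s * L) * σ2) := by ring
      _ ≤ _ := by gcongr

/-- The p-value of an inactive predictor is at least that of a slightly inflated chi-square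
variable. -/
lemma TypicalNoise.le_pValue {σ2 : ℝ} (hσ2 : 0 < σ2) {e : Fin n → ℝ}
    (he : D.TypicalNoise σ2 (WithLp.toLp 2 e)) (hlog : 1 ≤ Real.log n)
    (hx : 8 * Real.log n ≤ √n) {r : Fin D.M} (hr : r ∉ D.active) :
    1 - cdf (chiSq (D.p r)) ((1 + 4 * (Real.log n / √n)) *
        (‖(D.testSpace r).starProjection (WithLp.toLp 2 e)‖ ^ 2 / σ2))
      ≤ D.pValue (D.response e) r := by
  have hb : D.b r = 0 := by simpa [active] using hr
  obtain ⟨h1, -, h3⟩ := he.rss_pos_and_le hσ2 hlog hx (D.signal_mem_fullSpace D.β₀ D.b)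
  have hstat : D.lrStat r (D.response e) ≤ (1 + 4 * (Real.log n / √n)) *
        (‖(D.testSpace r).starProjection (WithLp.toLp 2 e)‖ ^ 2 / σ2) := by
    rw [lrStat, response_eq, div_le_iff₀ h1]
    -- As `b r = 0`, the signal lies in both spaces and the numerator sees only noise.
    rw [rss_add_of_mem (D.signal_mem_nullSpace D.β₀ hb),
      rss_add_of_mem (D.signal_mem_fullSpace D.β₀ D.b), rss_sub_rss,
      ← rss_add_of_mem (D.signal_mem_fullSpace D.β₀ D.b) (WithLp.toLp 2 e)]
    set Q := ‖(D.testSpace r).starProjection (WithLp.toLp 2 e)‖ ^ 2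
    have hQ : 0 ≤ Q / σ2 := by positivity
    calc Q = Q / σ2 * σ2 := by field_simp
      _ ≤ Q / σ2 * _ := mul_le_mul_of_nonneg_left h3 hQ
      _ = _ := by ring
  have := monotone_cdf (chiSq (D.p r)) hstat
  rw [pValue]
  linarith

/-- The p-value of a distinguishable predictor is small. -/
lemma TypicalNoise.pValue_le {σ2 c : ℝ} (hσ2 : 0 < σ2) (hc : 0 < c) {e : Fin n → ℝ}
    (he : D.TypicalNoise σ2 (WithLp.toLp 2 e)) (hlog : 1 ≤ Real.log n)
    (hx : 8 * Real.log n ≤ √n) (hcn : σ2 * √n ≤ c * n / 4) {r : Fin D.M}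
    (hr : ∀ (a₀ : ℝ) (a : (m : Fin D.M) → Fin (D.p m) → ℝ), a r = D.b r →
        c ≤ (∑ i, D.regression a₀ a i ^ 2) / n) :
    D.pValue (D.response e) r ≤ Real.exp (D.p r / 2 - c * n / (64 * σ2)) := by
  obtain ⟨h1, h2, -⟩ := he.rss_pos_and_le hσ2 hlog hx (D.signal_mem_fullSpace D.β₀ D.b)
  have hn : (0 : ℝ) < n := by
    rcases Nat.eq_zero_or_pos n with rfl | h
    · simp at hlog; linarith
    · exact_mod_cast h
  have hsig := D.le_norm_starProjection_signal_sq (r := r) (c := c * n) fun a₀ a ha =>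
    (le_div_iff₀ hn).1 (hr a₀ a ha)
  have hnoise : ‖(D.testSpace r).starProjection (WithLp.toLp 2 e)‖ ^ 2 ≤ c * n / 4 := by
    have h3 := (div_lt_iff₀ hσ2).1 he.1
    have h4 := norm_starProjection_mono (inf_le_right : D.testSpace r ≤ D.fullSpace)
      (WithLp.toLp 2 e)
    calc _ ≤ ‖D.fullSpace.starProjection (WithLp.toLp 2 e)‖ ^ 2 :=
          pow_le_pow_left₀ (norm_nonneg _) h4 2
      _ ≤ c * n / 4 := by linarith
  have hsum := le_norm_starProjection_add_sq (D.testSpace r) (by positivity) hsig hnoise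
  -- Signal and noise leave at least `cn/4` in the numerator, and `RSS / n ≤ 4σ²`. The tail rate
  -- `1/4` then yields the constant 64.
  have hstat : c * n / (16 * σ2) ≤ D.lrStat r (D.response e) := by
    rw [lrStat, response_eq, rss_sub_rss, le_div_iff₀ h1]
    calc _ ≤ c * n / (16 * σ2) * (4 * σ2) := by gcongr
      _ = c * n / 4 := by field_simp; norm_num
      _ ≤ _ := hsum
  refine D.pValue_le_iff _ _ hstat ?_
  rw [← ENNReal.ofReal_le_ofReal_iff (Real.exp_nonneg _), one_sub_cdf_eq]
  refine (measure_mono Set.Ioi_subset_Ici_self).trans ((chiSq_Ici_le _ _).trans (le_of_eq ?_))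
  congr 3
  field_simp
  ring

end Model

/-! ### Probability bounds for fixed `n` -/

section Noise

variable {Ω : Type*} [MeasurableSpace Ω] {μ : Measure Ω} [IsProbabilityMeasure μ] {n : ℕ}
  {D : Model n} {σ2 : NNReal} {ε : Fin n → Ω → ℝ}

lemma measure_not_typicalNoise_le (hσ2 : σ2 ≠ 0) (hindep : iIndepFun ε μ)
    (hlaw : ∀ i, HasLaw (ε i) (gaussianReal 0 σ2) μ) (hrank : LinearIndependent ℝ D.column)
    (hlog : 4 ≤ Real.log n) (hk : (D.k : ℝ) ≤ √n / Real.log n) :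
    μ {ω | ¬ D.TypicalNoise σ2 (WithLp.toLp 2 fun i => ε i ω)}
      ≤ ENNReal.ofReal (Real.exp (-(√n / 8))) + ENNReal.ofReal (Real.exp (1 - Real.log n))
        + ENNReal.ofReal (Real.exp (-(n / 2))) := by
  have hn : (0 : ℝ) < n := by
    rcases Nat.eq_zero_or_pos n with rfl | h
    · simp at hlog; linarith
    · exact_mod_cast h
  have l1 := hasLaw_starProjection_noise hσ2 hindep hlaw D.fullSpace
  have l2 := hasLaw_starProjection_noise hσ2 hindep hlaw ⊤
  rw [D.finrank_fullSpace hrank] at l1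
  simp only [Submodule.starProjection_top, finrank_top, finrank_euclideanSpace, Fintype.card_fin,
    ContinuousLinearMap.id_apply] at l2
  have hsub : {ω | ¬ D.TypicalNoise σ2 (WithLp.toLp 2 fun i => ε i ω)}
      ⊆ ({ω | ‖D.fullSpace.starProjection (WithLp.toLp 2 fun i => ε i ω)‖ ^ 2 / σ2 ∈ Set.Ici √n}
        ∪ {ω | ‖(WithLp.toLp 2 fun i => ε i ω : EuclideanSpace ℝ (Fin n))‖ ^ 2 / σ2
            ∈ Set.Iic (n - √n * Real.log n)})
        ∪ {ω | ‖(WithLp.toLp 2 fun i => ε i ω : EuclideanSpace ℝ (Fin n))‖ ^ 2 / σ2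
            ∈ Set.Ici (4 * (n : ℝ))} := by
    intro ω hω
    simp only [Set.mem_union, Set.mem_ofPred_eq, Set.mem_Ici, Set.mem_Iic]
    by_contra! h
    exact hω ⟨h.1.1, h.1.2, h.2⟩
  refine (measure_mono hsub).trans ((measure_union_le _ _).trans
    (add_le_add ((measure_union_le _ _).trans (add_le_add ?_ ?_)) ?_))
  · rw [measure_mem_eq_of_hasLaw l1 measurableSet_Ici]
    refine (chiSq_Ici_le _ _).trans (ENNReal.ofReal_le_ofReal (Real.exp_le_exp.2 ?_))
    -- Thus `k ≤ √n/4`, and the exponent `k/2 - √n/4` is at most `-√n/8`.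
    have : √n / Real.log n ≤ √n / 4 := by gcongr
    linarith
  · rw [measure_mem_eq_of_hasLaw l2 measurableSet_Iic]
    -- With `s = 1/√n` the deviation `√n log n` gives the exponent `1 - log n`.
    refine (chiSq_Iic_le n (s := 1 / √n) (by positivity) _).trans
      (ENNReal.ofReal_le_ofReal (Real.exp_le_exp.2 (le_of_eq ?_)))
    rw [div_pow, Real.sq_sqrt hn.le]
    have : √(n : ℝ) ≠ 0 := (Real.sqrt_pos.2 hn).ne'
    field_simp
    ring
  · rw [measure_mem_eq_of_hasLaw l2 measurableSet_Ici]
    refine (chiSq_Ici_le _ _).trans (ENNReal.ofReal_le_ofReal (Real.exp_le_exp.2 (le_of_eq ?_)))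
    ring

lemma measure_pValue_le_le (hσ2 : σ2 ≠ 0) (hindep : iIndepFun ε μ)
    (hlaw : ∀ i, HasLaw (ε i) (gaussianReal 0 σ2) μ) (hrank : LinearIndependent ℝ D.column)
    (hlog : 1 ≤ Real.log n) (hx : 8 * Real.log n ≤ √n) (hx2 : Real.log n ^ 2 ≤ √n)
    (hk : (D.k : ℝ) ≤ √n / Real.log n) {r : Fin D.M} (hr : r ∉ D.active) (t : ℝ) :
    μ {ω | D.TypicalNoise σ2 (WithLp.toLp 2 fun i => ε i ω) ∧
        D.pValue (D.response fun i => ε i ω) r ≤ t}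
      ≤ ENNReal.ofReal (Real.exp 40) * ENNReal.ofReal t + ENNReal.ofReal (1 / n) := by
  have hn : (0 : ℝ) < n := by
    rcases Nat.eq_zero_or_pos n with rfl | h
    · simp at hlog; linarith
    · exact_mod_cast h
  have hs : 0 < √(n : ℝ) := Real.sqrt_pos.2 hn
  have l := hasLaw_starProjection_noise hσ2 hindep hlaw (D.testSpace r)
  rw [D.finrank_testSpace hrank] at l
  set v := Real.log n / √n with hv
  have hv0 : 0 < v := by positivity
  have hv8 : 8 * v ≤ 1 := by
    rw [hv, ← mul_div_assoc, div_le_one hs]; exact hx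
  have hpk : (D.p r : ℝ) ≤ √n / Real.log n := le_trans (by exact_mod_cast D.p_le_k r) hk
  have hsub : {ω | D.TypicalNoise σ2 (WithLp.toLp 2 fun i => ε i ω) ∧
        D.pValue (D.response fun i => ε i ω) r ≤ t}
      ⊆ {ω | ‖(D.testSpace r).starProjection (WithLp.toLp 2 fun i => ε i ω)‖ ^ 2 / σ2
        ∈ {x | 1 - cdf (chiSq (D.p r)) ((1 + 4 * v) * x) ≤ t}} := fun ω hω =>
    (hω.1.le_pValue (by positivity) hlog hx hr).trans hω.2
  have hmeas : MeasurableSet {x | 1 - cdf (chiSq (D.p r)) ((1 + 4 * v) * x) ≤ t} := by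
    refine measurableSet_le (measurable_const.sub ?_) measurable_const
    exact (monotone_cdf _).measurable.comp (measurable_const_mul _)
  refine (measure_mono hsub).trans ?_
  rw [measure_mem_eq_of_hasLaw l hmeas]
  -- `κ'` only has to exceed `κ = 1 + 4v`. This `X` makes the tail term `exp(-p/2 - log n) ≤ 1/n`.
  -- By (C1) `v p ≤ 1`, and `v log n ≤ 1`, so `5v · X ≤ 80 = 2B`.
  refine (chiSq_one_sub_cdf_le (D.p_pos r) (κ' := 1 + 5 * v) (X := 8 * (D.p r + Real.log n))
    (B := 40) (by linarith) (by linarith) (by linarith) (by positivity) (by norm_num) ?_).trans ?_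
  · have h1 : v * D.p r ≤ 1 := by
      calc v * D.p r ≤ v * (√n / Real.log n) := by gcongr
        _ = 1 := by rw [hv]; field_simp
    have h2 : v * Real.log n ≤ 1 := by
      rw [hv, div_mul_eq_mul_div, div_le_one hs, ← sq]; exact hx2
    nlinarith
  · refine add_le_add le_rfl (ENNReal.ofReal_le_ofReal ?_)
    rw [one_div, ← Real.exp_log (inv_pos.2 hn), Real.log_inv]
    refine Real.exp_le_exp.2 ?_
    have : (0 : ℝ) ≤ D.p r := Nat.cast_nonneg _
    linarith

end Noise

lemma eventually_large (a : ℝ) : ∀ᶠ n : ℕ in atTop, 4 ≤ Real.log n ∧ 8 * Real.log n ≤ √n ∧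
    Real.log n ^ 2 ≤ √n ∧ a * √n ≤ n := by
  have hcast := tendsto_natCast_atTop_atTop (R := ℝ)
  have hlog := Real.tendsto_log_atTop.comp hcast
  have hsqrt := Real.tendsto_sqrt_atTop.comp hcast
  have h2 := hcast.eventually ((Real.isLittleO_pow_log_id_atTop (n := 2)).bound
    (show (0 : ℝ) < 1 / 64 by norm_num))
  have h4 := hcast.eventually ((Real.isLittleO_pow_log_id_atTop (n := 4)).bound one_pos)
  filter_upwards [hlog.eventually_ge_atTop 4, hsqrt.eventually_ge_atTop a, h2, h4]
    with n h1 h3 h2 h4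
  simp only [Function.comp_apply, id, Real.norm_eq_abs, Nat.abs_cast, abs_pow] at h1 h3 h2 h4
  rw [← abs_pow, abs_of_nonneg (by positivity)] at h2 h4
  refine ⟨h1, ?_, ?_, ?_⟩
  · exact Real.le_sqrt_of_sq_le (by linarith)
  · exact Real.le_sqrt_of_sq_le (by linarith)
  · calc a * √n ≤ √n * √n := by gcongr
      _ = n := Real.mul_self_sqrt (Nat.cast_nonneg n)

lemma log_le_sum_inv (M : ℕ) : Real.log M ≤ ∑ l ∈ Finset.Icc 1 M, (l : ℝ)⁻¹ := by
  rcases Nat.eq_zero_or_pos M with rfl | hM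
  · simp
  have h := log_add_one_le_harmonic M
  rw [harmonic_eq_sum_Icc] at h
  push_cast at h
  exact (Real.log_le_log (by exact_mod_cast hM) (by linarith)).trans h

lemma one_le_sum_inv {M : ℕ} (hM : 0 < M) : 1 ≤ ∑ l ∈ Finset.Icc 1 M, (l : ℝ)⁻¹ := by
  have := Finset.single_le_sum (f := fun l : ℕ => (l : ℝ)⁻¹) (s := Finset.Icc 1 M) (a := 1)
    (fun l _ => by positivity) (by simp; omega)
  simpa using this

/-- The p-values of the active predictors are at most `n⁻²`, and the others are above `t`. -/
def Model.Separated {n : ℕ} (D : Model n) (t : ℝ) (π : Fin D.M → ℝ) : Prop :=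
  (∀ r ∈ D.active, π r ≤ 1 / (n : ℝ) ^ 2) ∧ ∀ r ∉ D.active, t < π r

section Fixed

variable {Ω : Type*} [MeasurableSpace Ω] {μ : Measure Ω} [IsProbabilityMeasure μ] {n : ℕ}
  {D : Model n} {σ2 : NNReal} {ε : Fin n → Ω → ℝ}

lemma measure_not_separated_le (hσ2 : σ2 ≠ 0) (hindep : iIndepFun ε μ)
    (hlaw : ∀ i, HasLaw (ε i) (gaussianReal 0 σ2) μ) (hrank : LinearIndependent ℝ D.column)
    (hlog : 4 ≤ Real.log n) (hx : 8 * Real.log n ≤ √n) (hx2 : Real.log n ^ 2 ≤ √n)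
    (hk : (D.k : ℝ) ≤ √n / Real.log n) {c : ℝ} (hc : 0 < c) (hcn : 64 * σ2 / c * √n ≤ n)
    (hdesign : ∀ r ∈ D.active,
      ∀ (a₀ : ℝ) (a : (m : Fin D.M) → Fin (D.p m) → ℝ), a r = D.b r →
        c ≤ (∑ i, D.regression a₀ a i ^ 2) / n) (t : ℝ) :
    μ {ω | ¬ D.Separated t (D.pValue (D.response fun i => ε i ω))}
      ≤ ENNReal.ofReal (Real.exp (-(√n / 8))) + ENNReal.ofReal (Real.exp (1 - Real.log n))
        + ENNReal.ofReal (Real.exp (-(n / 2)))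
        + (ENNReal.ofReal (Real.exp 40) * ENNReal.ofReal (D.activeᶜ.card * t)
          + ENNReal.ofReal (1 / √n)) := by
  have hn : (0 : ℝ) < n := by
    rcases Nat.eq_zero_or_pos n with rfl | h
    · simp at hlog; linarith
    · exact_mod_cast h
  have hs : 0 < √(n : ℝ) := Real.sqrt_pos.2 hn
  have hσ : (0 : ℝ) < σ2 := by positivity
  have hk' : (D.k : ℝ) ≤ √n := hk.trans (div_le_self hs.le (by linarith))
  have hcn' : σ2 * √n ≤ c * n / 64 := by
    rw [div_mul_eq_mul_div, div_le_iff₀ hc] at hcn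
    linarith
  have hcn0 : 0 < c * n := by positivity
  have hsub : {ω | ¬ D.Separated t (D.pValue (D.response fun i => ε i ω))}
      ⊆ {ω | ¬ D.TypicalNoise σ2 (WithLp.toLp 2 fun i => ε i ω)}
        ∪ ⋃ r ∈ D.activeᶜ, {ω | D.TypicalNoise σ2 (WithLp.toLp 2 fun i => ε i ω) ∧
          D.pValue (D.response fun i => ε i ω) r ≤ t} := by
    intro ω hω
    by_contra h
    simp only [Set.mem_union, Set.mem_ofPred_eq, Set.mem_iUnion, not_or, not_not, not_exists,
      not_and, not_le, Finset.mem_compl] at h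
    obtain ⟨htyp, hin⟩ := h
    refine hω ⟨fun r hr => ?_, fun r hr => hin r hr htyp⟩
    refine (htyp.pValue_le hσ hc (by linarith) hx (by linarith) (hdesign r hr)).trans ?_
    have hp : (D.p r : ℝ) ≤ √n := le_trans (by exact_mod_cast D.p_le_k r) hk'
    -- With `p ≤ √n` the exponent is at most `-√n/2`, which is at most `-2 log n`.
    have h1 : √n ≤ c * n / (64 * σ2) := by
      rw [le_div_iff₀ (by positivity)]; linarith
    rw [one_div, ← Real.exp_log (show 0 < ((n : ℝ) ^ 2)⁻¹ by positivity), Real.log_inv,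
      Real.log_pow]
    refine Real.exp_le_exp.2 ?_
    push_cast
    linarith
  refine (measure_mono hsub).trans ((measure_union_le _ _).trans (add_le_add
    (measure_not_typicalNoise_le hσ2 hindep hlaw hrank hlog hk) ?_))
  refine (measure_biUnion_finset_le _ _).trans ((Finset.sum_le_sum fun r hr =>
    measure_pValue_le_le hσ2 hindep hlaw hrank (by linarith) hx hx2 hk
      (Finset.mem_compl.1 hr) t).trans ?_)
  rw [Finset.sum_const, nsmul_eq_mul, mul_add, mul_left_comm, ← ENNReal.ofReal_natCast,
    ← ENNReal.ofReal_mul (q := t) (by positivity),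
    ← ENNReal.ofReal_mul (q := 1 / (n : ℝ)) (by positivity)]
  refine add_le_add le_rfl (ENNReal.ofReal_le_ofReal ?_)
  -- There are at most `M ≤ k ≤ √n` inactive predictors, so the terms `1/n` add up to at most
  -- `1/√n`.
  have h2 : (D.activeᶜ.card : ℝ) ≤ √n := by
    have h3 : D.activeᶜ.card ≤ D.k := (by simpa using D.activeᶜ.card_le_univ :
      D.activeᶜ.card ≤ D.M).trans D.M_le_k
    exact le_trans (by exact_mod_cast h3) hk'
  calc (D.activeᶜ.card : ℝ) * (1 / n) ≤ √n * (1 / n) := by gcongr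
    _ = 1 / √n := by
      nth_rewrite 2 [← Real.mul_self_sqrt hn.le]
      field_simp

end Fixed

/-! ### Asymptotics and the two selections -/

/-- The threshold `t` stays free so that both procedures are covered; only `#inactive · t` has to
vanish. -/
lemma tendsto_measure_not_separated {Ω : Type*} [MeasurableSpace Ω] {μ : Measure Ω}
    [IsProbabilityMeasure μ] {D : (n : ℕ) → Model n} {σ2 : NNReal} (hσ2 : σ2 ≠ 0)
    {ε : (n : ℕ) → Fin n → Ω → ℝ} (hε_indep : ∀ n, iIndepFun (ε n) μ)
    (hε_law : ∀ n i, HasLaw (ε n i) (gaussianReal 0 σ2) μ)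
    (hrank : ∀ᶠ n in atTop, LinearIndependent ℝ (D n).column)
    (hdesign : ∃ c : ℝ, 0 < c ∧ ∀ᶠ n in atTop, ∀ r ∈ (D n).active,
      ∀ (a₀ : ℝ) (a : (m : Fin (D n).M) → Fin ((D n).p m) → ℝ), a r = (D n).b r →
        c ≤ (∑ i, (D n).regression a₀ a i ^ 2) / n)
    (hC1 : ∀ᶠ n : ℕ in atTop, ((D n).k : ℝ) ≤ Real.sqrt n / Real.log n)
    {t g : ℕ → ℝ} (hg : Tendsto g atTop (𝓝 0))
    (ht : ∀ᶠ n in atTop, ((D n).activeᶜ.card : ℝ) * t n ≤ g n) :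
    Tendsto (fun n => μ {ω | ¬ (D n).Separated (t n)
      ((D n).pValue ((D n).response fun i => ε n i ω))}) atTop (𝓝 0) := by
  obtain ⟨c, hc, hdesign⟩ := hdesign
  have hcast := tendsto_natCast_atTop_atTop (R := ℝ)
  have hlog := Real.tendsto_log_atTop.comp hcast
  have hsqrt := Real.tendsto_sqrt_atTop.comp hcast
  have e1 : Tendsto (fun n : ℕ => Real.exp (-(√n / 8))) atTop (𝓝 0) :=
    Real.tendsto_exp_neg_atTop_nhds_zero.comp (hsqrt.atTop_div_const (by norm_num))
  have e2 : Tendsto (fun n : ℕ => Real.exp (1 - Real.log n)) atTop (𝓝 0) :=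
    Real.tendsto_exp_atBot.comp
      (tendsto_atBot_add_const_left _ 1 (tendsto_neg_atTop_atBot.comp hlog))
  have e3 : Tendsto (fun n : ℕ => Real.exp (-((n : ℝ) / 2))) atTop (𝓝 0) :=
    Real.tendsto_exp_neg_atTop_nhds_zero.comp (hcast.atTop_div_const (by norm_num))
  have e4 : Tendsto (fun n : ℕ => 1 / √(n : ℝ)) atTop (𝓝 0) := by
    simp_rw [one_div]
    exact tendsto_inv_atTop_zero.comp hsqrt
  have hB : Tendsto (fun n : ℕ => ENNReal.ofReal (Real.exp (-(√n / 8)))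
      + ENNReal.ofReal (Real.exp (1 - Real.log n)) + ENNReal.ofReal (Real.exp (-(n / 2)))
      + (ENNReal.ofReal (Real.exp 40) * ENNReal.ofReal (g n) + ENNReal.ofReal (1 / √n)))
      atTop (𝓝 0) := by
    have h := (((ENNReal.tendsto_ofReal e1).add (ENNReal.tendsto_ofReal e2)).add
      (ENNReal.tendsto_ofReal e3)).add ((ENNReal.Tendsto.const_mul (a := ENNReal.ofReal (Real.exp 40))
        (ENNReal.tendsto_ofReal hg) (Or.inr ENNReal.ofReal_ne_top)).add
          (ENNReal.tendsto_ofReal e4))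
    simpa using h
  refine tendsto_of_tendsto_of_tendsto_of_le_of_le' tendsto_const_nhds hB
    (Eventually.of_forall fun _ => zero_le) ?_
  filter_upwards [hrank, hdesign, hC1, ht, eventually_large (64 * σ2 / c)]
    with n h1 h2 h3 h4 ⟨l1, l2, l3, l4⟩
  refine (measure_not_separated_le hσ2 (hε_indep n) (hε_law n) h1 l1 l2 l3 h3 hc l4 h2
    (t n)).trans ?_
  gcongr

lemma tendsto_measure_one_of_compl {Ω : Type*} [MeasurableSpace Ω] {μ : Measure Ω}
    [IsProbabilityMeasure μ] {P Q : ℕ → Ω → Prop}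
    (h : Tendsto (fun n => μ {ω | ¬ Q n ω}) atTop (𝓝 0))
    (hQP : ∀ᶠ n in atTop, ∀ ω, Q n ω → P n ω) :
    Tendsto (fun n => μ {ω | P n ω}) atTop (𝓝 1) := by
  have h1 : Tendsto (fun n => 1 - μ {ω | ¬ Q n ω}) atTop (𝓝 1) := by
    simpa using ENNReal.Tendsto.sub tendsto_const_nhds h (Or.inl ENNReal.one_ne_top)
  refine tendsto_of_tendsto_of_tendsto_of_le_of_le' h1 tendsto_const_nhds ?_
    (Eventually.of_forall fun _ => prob_le_one)
  filter_upwards [hQP] with n hn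
  rw [tsub_le_iff_right, ← measure_univ (μ := μ)]
  refine (measure_mono fun ω _ => ?_).trans (measure_union_le _ _)
  by_cases hω : Q n ω
  · exact Or.inl (hn ω hω)
  · exact Or.inr hω

end FunReg

theorem theorem3p4
    {Ω : Type*} [MeasurableSpace Ω] (μ : Measure Ω) [IsProbabilityMeasure μ]
    -- for every sample size `n`, a functional regression model with `n` observations
    (D : (n : ℕ) → FunReg.Model n)
    -- i.i.d. Gaussian noise with mean `0` and constant variance `σ2 > 0`
    (σ2 : NNReal) (hσ2 : σ2 ≠ 0)
    (ε : (n : ℕ) → Fin n → Ω → ℝ)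
    (hε_indep : ∀ n, iIndepFun (ε n) μ)
    (hε_law : ∀ n i, HasLaw (ε n i) (gaussianReal 0 σ2) μ)
    -- the design matrix has full rank
    (hrank : ∀ᶠ n in atTop, LinearIndependent ℝ (D n).column)
    -- there is at least one significant predictor
    (hactive : ∀ᶠ n in atTop, (D n).active.Nonempty)
    -- the contribution of a significant predictor cannot be reproduced asymptotically by the
    -- intercept and the other predictors
    (hdesign : ∃ c : ℝ, 0 < c ∧ ∀ᶠ n in atTop, ∀ r ∈ (D n).active,
      ∀ (a₀ : ℝ) (a : (m : Fin (D n).M) → Fin ((D n).p m) → ℝ), a r = (D n).b r →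
        c ≤ (∑ i, (D n).regression a₀ a i ^ 2) / n)
    -- condition (C1)
    (hC1 : ∀ᶠ n : ℕ in atTop, ((D n).k : ℝ) ≤ Real.sqrt n / Real.log n)
    -- the level
    (q : ℕ → ℝ) (hq : Tendsto q atTop (𝓝 0))
    (hq_lower : ∀ᶠ n : ℕ in atTop,
      ((D n).M : ℝ) * (∑ l ∈ Finset.Icc 1 (D n).M, (l : ℝ)⁻¹) / (((D n).active.card : ℝ) * n)
        ≤ q n)
    (hq_upper : Tendsto (fun n => ((D n).M : ℝ) * q n / Real.log (D n).M) atTop (𝓝 0)) :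
    Tendsto (fun n => μ {ω | FunReg.benjaminiYekutieli
        ((D n).pValue ((D n).response fun i => ε n i ω)) (q n) = (D n).active}) atTop (𝓝 1) ∧
    Tendsto (fun n => μ {ω | FunReg.bonferroni
        ((D n).pValue ((D n).response fun i => ε n i ω)) (q n) = (D n).active}) atTop (𝓝 1) := by
  have hM : ∀ᶠ n in atTop, (D n).active.card ≤ (D n).M ∧ 0 < (D n).active.card ∧
      (D n).activeᶜ.card = (D n).M - (D n).active.card := by
    filter_upwards [hactive] with n hn
    exact ⟨by simpa using (D n).active.card_le_univ, hn.card_pos, by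
      rw [Finset.card_compl, Fintype.card_fin]⟩
  have hMn : ∀ᶠ n : ℕ in atTop, (0 : ℝ) < n ∧ ((D n).M : ℝ) ≤ n := by
    filter_upwards [hC1, FunReg.eventually_large 1] with n hk ⟨h1, _, _, h2⟩
    have hn : (0 : ℝ) < n := by
      rcases Nat.eq_zero_or_pos n with rfl | h
      · simp at h1; linarith
      · exact_mod_cast h
    have hMk : ((D n).M : ℝ) ≤ (D n).k := by exact_mod_cast (D n).M_le_k
    exact ⟨hn, hMk.trans (hk.trans ((div_le_self (Real.sqrt_nonneg _) (by linarith)).trans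
      (by linarith)))⟩
  have hq0 : ∀ᶠ n in atTop, 0 ≤ q n := by
    filter_upwards [hq_lower] with n hn
    exact le_trans (div_nonneg (mul_nonneg (Nat.cast_nonneg _)
      (Finset.sum_nonneg fun l _ => by positivity)) (by positivity)) hn
  constructor
  · refine FunReg.tendsto_measure_one_of_compl (FunReg.tendsto_measure_not_separated hσ2 hε_indep
      hε_law hrank hdesign hC1 (t := fun n => q n / ∑ l ∈ Finset.Icc 1 (D n).M, (l : ℝ)⁻¹)
      hq_upper ?_) ?_
    · filter_upwards [hM, hq0] with n ⟨h1, h2, h3⟩ hq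
      -- For `M ≥ 2` the harmonic sum dominates `log M`. For `M = 1`, where `log M = 0`, the only
      -- predictor is active and the union bound is empty.
      rcases Nat.lt_or_ge 1 (D n).M with hM1 | hM1
      · have hlog : 0 < Real.log (D n).M := Real.log_pos (by exact_mod_cast hM1)
        have hcard : ((D n).activeᶜ.card : ℝ) ≤ (D n).M := by
          rw [h3]; exact_mod_cast Nat.sub_le _ _
        rw [mul_div_assoc]
        exact mul_le_mul hcard (div_le_div_of_nonneg_left hq hlog (FunReg.log_le_sum_inv _))
          (div_nonneg hq (hlog.le.trans (FunReg.log_le_sum_inv _))) (Nat.cast_nonneg _)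
      · have h4 : (D n).M = 1 := by omega
        have h5 : (D n).activeᶜ.card = 0 := by omega
        simp [h4, h5]
    · filter_upwards [hM, hMn, hq0, hq_lower, hactive] with n ⟨h1, h2, _⟩ ⟨hn, hMn⟩ hq hql hact ω hω
      have hH := FunReg.one_le_sum_inv (h2.trans_le h1)
      set H := ∑ l ∈ Finset.Icc 1 (D n).M, (l : ℝ)⁻¹
      have hM0 : (0 : ℝ) < (D n).M := by exact_mod_cast h2.trans_le h1
      have hc0 : (0 : ℝ) < (D n).active.card := by exact_mod_cast h2
      refine FunReg.benjaminiYekutieli_eq hq hact (fun r hr => (hω.1 r hr).trans ?_) hω.2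
      have hn1 : (1 : ℝ) ≤ n := by exact_mod_cast (by exact_mod_cast hn : 0 < n)
      rw [div_le_iff₀ (by positivity)] at hql
      calc 1 / (n : ℝ) ^ 2 ≤ 1 / n := by
            refine one_div_le_one_div_of_le hn ?_
            nlinarith
        -- This is the lower bound on `q`, rearranged.
        _ ≤ (D n).active.card / (D n).M * (q n / H) := by
            rw [div_mul_div_comm, div_le_div_iff₀ hn (by positivity)]
            linarith
  · refine FunReg.tendsto_measure_one_of_compl (FunReg.tendsto_measure_not_separated hσ2 hε_indep
      hε_law hrank hdesign hC1 (t := fun n => q n / (D n).M) hq ?_) ?_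
    · filter_upwards [hM, hq0] with n ⟨h1, h2, h3⟩ hq
      have hM0 : (0 : ℝ) < (D n).M := by exact_mod_cast h2.trans_le h1
      have hcard : ((D n).activeᶜ.card : ℝ) ≤ (D n).M := by
        rw [h3]; exact_mod_cast Nat.sub_le _ _
      rw [mul_div_assoc', div_le_iff₀ hM0, mul_comm]
      gcongr
    · filter_upwards [hM, hMn, hq_lower] with n ⟨h1, h2, _⟩ ⟨hn, hMn⟩ hql ω hω
      have hH := FunReg.one_le_sum_inv (h2.trans_le h1)
      set H := ∑ l ∈ Finset.Icc 1 (D n).M, (l : ℝ)⁻¹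
      have hM0 : (0 : ℝ) < (D n).M := by exact_mod_cast h2.trans_le h1
      have hc0 : (0 : ℝ) < (D n).active.card := by exact_mod_cast h2
      have hcn : ((D n).active.card : ℝ) ≤ n := le_trans (by exact_mod_cast h1) hMn
      refine FunReg.bonferroni_eq (fun r hr => (hω.1 r hr).trans ?_) hω.2
      rw [le_div_iff₀ hM0]
      -- The lower bound on `q` suffices because `M₀ ≤ M ≤ n` and `H ≥ 1`.
      refine le_trans ?_ hql
      rw [div_mul_eq_mul_div, one_mul, div_le_div_iff₀ (by positivity) (by positivity)]
      calc ((D n).M : ℝ) * ((D n).active.card * n) ≤ (D n).M * (n * n) := by gcongr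
        _ = (D n).M * 1 * (n : ℝ) ^ 2 := by ring
        _ ≤ (D n).M * H * (n : ℝ) ^ 2 := by gcongr
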